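/- Let $n\ge 1$ and let $\mathbb H$ be the real quaternions, with units $i,j,k$ and modulus $|\cdot|$. For $f,g\in L^2(\mathbb R^{2n},\mathbb H)$ put $\langle f,g\rangle_Q=\int_{\mathbb R^{2n}} f(x)\overline{g(x)}\,dx$. Let $\mathcal F_Q$ be the two-sided quaternion Fourier transform $$\mathcal F_Q(f)(u,v)=\int_{\mathbb R^n\times\mathbb R^n} e^{-2\pi i\,u\cdot x} f(x,y)\, e^{-2\pi j\,v\cdot y}\,dx\,dy,\qquad u,v\in\mathbb R^n,$$ defined in this way on $L^1\cap L^2$ and extended by continuity to $L^2(\mathbb R^{2n},\mathbb H)$. For $a\in\mathbb R^*=\mathbb R\setminus\{0\}$ and $s\in\mathbb R^{2n-1}$ let $$A_a=\begin{pmatrix} a&0\\0&\operatorname{sgn}(a)|a|^{1/(2n)}I_{2n-1}\end{pmatrix},\qquad S_s=\begin{pmatrix}1&s^T\\0&I_{2n-1}\end{pmatrix}.$$ For $\psi\in L^2(\mathbb R^{2n},\mathbb H)$ and $(a,s,t)\in X:=\mathbb R^*\times\mathbb R^{2n-1}\times\mathbb R^{2n}$ let $$\psi_{a,s,t}(x)=|a|^{\frac1{4n}-1}\,\psi\big(A_a^{-1}S_s^{-1}(x-t)\big),\qquad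 \psi^*(x)=\overline{\psi(-x)},\qquad d\mu(a,s,t)=\frac{da\,ds\,dt}{|a|^{2n+1}}.$$ Let $\psi\in L^2(\mathbb R^{2n},\mathbb H)$, $\psi\neq0$, be admissible, i.e. $$C_\psi=\int_{\mathbb R^{2n}}\frac{|\mathcal F_Q(\psi^*)(\lambda)|^2}{|\lambda_1|^{2n}}\,d\lambda<\infty .$$ Assume that for every $t\in\mathbb R^n$ and almost every $(u,v)\in\mathbb R^n\times\mathbb R^n$ $$\mathcal F_Q(\psi)(u,v)\,e^{-2\pi j\,v\cdot t}=e^{-2\pi j\,v\cdot t}\,\mathcal F_Q(\psi)(u,v),\qquad \mathcal F_Q(j\psi)(u,v)\,e^{-2\pi j\,v\cdot t}=j\,e^{-2\pi j\,v\cdot t}\,\mathcal F_Q(\psi)(u,v).$$ For $f\in L^2(\mathbb R^{2n},\mathbb H)$ let $\mathcal{SH}^Q_\psi(f)(a,s,t)=\langle f,\psi_{a,s,t}\rangle_Q$ be its continuous quaternion shearlet transform. Then $C_\psi>0$, and $\mathcal H=\mathcal{SH}^Q_\psi\big(L^2(\mathbb R^{2n},\mathbb H)\big)$ is a reproducing kernel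 Hilbert space in $L^2(d\mu)$ with kernel $$\mathcal K_\psi\big((a,s,t),(a',s',t')\big)=\frac1{C_\psi}\,\langle\psi_{a,s,t},\psi_{a',s',t'}\rangle_Q .$$ That is, $\mathcal H$ is a left $\mathbb H$-linear space of $\mu$-square-integrable functions on $X$; two functions in $\mathcal H$ that agree $\mu$-almost everywhere are equal; $\mathcal H$ is closed in $L^2(d\mu)$; $\mathcal K_\psi(p,\cdot)\in\mathcal H$ for every $p\in X$; and for all $F\in\mathcal H$ and $p\in X$ $$F(p)=\int_X F(q)\,\overline{\mathcal K_\psi(p,q)}\,d\mu(q),$$ where the integral converges absolutely. Moreover the kernel is pointwise bounded: for all $p,q\in X$ $$|\mathcal K_\psi(p,q)|\le\frac{\|\psi\|_2^2}{C_\psi}.$$ -/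

import Mathlib

open MeasureTheory Filter Topology
open scoped Quaternion ENNReal

noncomputable section

namespace QShearlet

/-- Euclidean space `ℝ^d`, with its Lebesgue measure. -/
abbrev Space (d : ℕ) : Type := EuclideanSpace ℝ (Fin d)

/-- The quaternion unit `i`. -/
def unitI : ℍ[ℝ] := ⟨0, 1, 0, 0⟩

/-- The quaternion unit `j`. -/
def unitJ : ℍ[ℝ] := ⟨0, 0, 1, 0⟩

/-- The first half `x ∈ ℝⁿ` of `(x, y) ∈ ℝ²ⁿ`. -/
def fstHalf {n : ℕ} (w : Space (2 * n)) : Space n :=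
  WithLp.toLp 2 fun k => w ⟨k.val, by omega⟩

/-- The second half `y ∈ ℝⁿ` of `(x, y) ∈ ℝ²ⁿ`. -/
def sndHalf {n : ℕ} (w : Space (2 * n)) : Space n :=
  WithLp.toLp 2 fun k => w ⟨n + k.val, by omega⟩

/-- The left factor `e^{-2πi u·x}` of the two-sided transform. -/
def expI {n : ℕ} (u x : Space n) : ℍ[ℝ] :=
  NormedSpace.exp ((-(2 * Real.pi * inner ℝ u x)) • unitI)

/-- The right factor `e^{-2πj v·y}` of the two-sided transform. -/
def expJ {n : ℕ} (v y : Space n) : ℍ[ℝ] :=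
  NormedSpace.exp ((-(2 * Real.pi * inner ℝ v y)) • unitJ)

/-- The two-sided quaternion Fourier integral
`(u, v) ↦ ∫ e^{-2πi u·x} f(x, y) e^{-2πj v·y} dx dy`, for integrable `f`. -/
def qftIntegral {n : ℕ} (f : Space (2 * n) → ℍ[ℝ]) (w : Space (2 * n)) : ℍ[ℝ] :=
  ∫ z, expI (fstHalf w) (fstHalf z) * f z * expJ (sndHalf w) (sndHalf z)

/-- `g` is (a representative of) the `L²` quaternion Fourier transform of `f ∈ L²`: the `L²` limit
of the Fourier integrals of the truncations of `f` to balls, which lie in `L¹ ∩ L²` and converge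
to `f` in `L²`. -/
def IsQFT {n : ℕ} (f g : Space (2 * n) → ℍ[ℝ]) : Prop :=
  MemLp g 2 volume ∧
    Tendsto
      (fun R : ℕ => eLpNorm
        (fun w => qftIntegral ((Metric.closedBall 0 (R : ℝ)).indicator f) w - g w) 2 volume)
      atTop (𝓝 0)

/-- The quaternion Fourier transform on `L²(ℝ²ⁿ, ℍ)`, i.e. the extension by continuity of the
Fourier integral from `L¹ ∩ L²`; it is determined up to a null set. -/
def qft {n : ℕ} (f : Space (2 * n) → ℍ[ℝ]) : Space (2 * n) → ℍ[ℝ] :=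
  Classical.epsilon (IsQFT f)

/-- The commutation hypothesis of the convolution theorem for the quaternion Fourier transform:
`F_Q(g)(u,v) e^{-2πj v·t} = e^{-2πj v·t} F_Q(g)(u,v)` and
`F_Q(jg)(u,v) e^{-2πj v·t} = j e^{-2πj v·t} F_Q(g)(u,v)` for all `t ∈ ℝⁿ`
(as identities of `L²` functions of `(u,v)`). -/
def ConvolutionCondition {n : ℕ} (g : Space (2 * n) → ℍ[ℝ]) : Prop :=
  ∀ t : Space n,
    (∀ᵐ w : Space (2 * n), qft g w * expJ (sndHalf w) t = expJ (sndHalf w) t * qft g w) ∧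
    (∀ᵐ w : Space (2 * n),
      qft (fun z => unitJ * g z) w * expJ (sndHalf w) t
        = unitJ * expJ (sndHalf w) t * qft g w)

/-- The dilation matrix `A_a = diag(a, sgn(a)|a|^{1/(2n)}, …, sgn(a)|a|^{1/(2n)})`. -/
def dilation (n : ℕ) (a : ℝ) : Matrix (Fin (2 * n)) (Fin (2 * n)) ℝ :=
  Matrix.diagonal fun k =>
    if k.val = 0 then a else Real.sign a * |a| ^ (1 / (2 * (n : ℝ)))

/-- The shear matrix `S_s`: the identity, except that its first row is `(1, s₁, …, s_{2n-1})`. -/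
def shear {n : ℕ} (s : Space (2 * n - 1)) : Matrix (Fin (2 * n)) (Fin (2 * n)) ℝ :=
  Matrix.of fun k l =>
    if k = l then 1
    else if h : k.val = 0 ∧ 0 < l.val then s ⟨l.val - 1, by omega⟩
    else 0

/-- The parameter space `ℝ* × ℝ²ⁿ⁻¹ × ℝ²ⁿ` of the full shearlet group. -/
abbrev Param (n : ℕ) : Type := {a : ℝ // a ≠ 0} × Space (2 * n - 1) × Space (2 * n)

/-- The left Haar measure `dμ = |a|^{-(2n+1)} da ds dt`. -/
def haarLeft (n : ℕ) : Measure (Param n) :=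
  (((volume : Measure ℝ).comap (Subtype.val : {a : ℝ // a ≠ 0} → ℝ)).prod
      ((volume : Measure (Space (2 * n - 1))).prod (volume : Measure (Space (2 * n))))).withDensity
    fun p => ENNReal.ofReal (1 / |(p.1 : ℝ)| ^ (2 * n + 1))

/-- `ψ_{a,s,t}(x) = |a|^{1/(4n) - 1} ψ(A_a⁻¹ S_s⁻¹ (x - t))`. -/
def shearlet {n : ℕ} (ψ : Space (2 * n) → ℍ[ℝ]) (p : Param n) (x : Space (2 * n)) : ℍ[ℝ] :=
  (|(p.1 : ℝ)| ^ (1 / (4 * (n : ℝ)) - 1)) •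
    ψ (WithLp.toLp 2
      ((dilation n (p.1 : ℝ))⁻¹.mulVec ((shear p.2.1)⁻¹.mulVec (x - p.2.2).ofLp)))

/-- The quaternion-valued inner product `⟨f, g⟩_Q = ∫ f(x) conj(g(x)) dx`. -/
def innerQ {n : ℕ} (f g : Space (2 * n) → ℍ[ℝ]) : ℍ[ℝ] := ∫ x, f x * star (g x)

/-- `ψ*(x) = conj(ψ(-x))`. -/
def reflConj {n : ℕ} (ψ : Space (2 * n) → ℍ[ℝ]) (x : Space (2 * n)) : ℍ[ℝ] := star (ψ (-x))

/-- `∫ |F_Q(ψ*)(λ)|² / |λ₁|^{2n} dλ`, as an element of `[0, ∞]`. -/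
def admissibilityIntegral {n : ℕ} [NeZero n] (ψ : Space (2 * n) → ℍ[ℝ]) : ℝ≥0∞ :=
  ∫⁻ w : Space (2 * n), ‖qft (reflConj ψ) w‖ₑ ^ 2 /
    ENNReal.ofReal (|w ⟨0, Nat.mul_pos two_pos (NeZero.pos n)⟩| ^ (2 * n))

/-- `ψ ∈ L²(ℝ²ⁿ, ℍ)` is an admissible quaternion shearlet. -/
def Admissible {n : ℕ} [NeZero n] (ψ : Space (2 * n) → ℍ[ℝ]) : Prop :=
  MemLp ψ 2 volume ∧ admissibilityIntegral ψ < ∞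

/-- The admissibility constant `C_ψ`. -/
def admissibilityConst {n : ℕ} [NeZero n] (ψ : Space (2 * n) → ℍ[ℝ]) : ℝ :=
  (admissibilityIntegral ψ).toReal

/-- The continuous quaternion shearlet transform `SH_ψ(f)(a,s,t) = ⟨f, ψ_{a,s,t}⟩_Q`. -/
def shearletTransform {n : ℕ} (ψ f : Space (2 * n) → ℍ[ℝ]) (p : Param n) : ℍ[ℝ] :=
  innerQ f (shearlet ψ p)

/-- The range `SH_ψ(L²(ℝ²ⁿ, ℍ))`, as a set of functions on the parameter space. -/
def transformRange {n : ℕ} (ψ : Space (2 * n) → ℍ[ℝ]) : Set (Param n → ℍ[ℝ]) :=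
  {F | ∃ f : Space (2 * n) → ℍ[ℝ], MemLp f 2 volume ∧ F = shearletTransform ψ f}

/-- The kernel `K_ψ(p, p') = (1 / C_ψ) ⟨ψ_p, ψ_{p'}⟩_Q`. -/
def shearletKernel {n : ℕ} [NeZero n] (ψ : Space (2 * n) → ℍ[ℝ]) (p q : Param n) : ℍ[ℝ] :=
  (1 / admissibilityConst ψ) • innerQ (shearlet ψ p) (shearlet ψ q)

/-- The set `H` of quaternion-valued functions on `X` is a (left quaternionic) reproducing kernel
Hilbert space inside `L²(μ)`, with kernel `K`, for the inner product `∫ F conj(G) dμ` of `L²(μ)`: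
`H` is a left `ℍ`-linear space of square integrable functions, its elements are determined by
their classes in `L²(μ)`, these classes form a closed subspace of `L²(μ)` (so `H` is complete),
each `K(x, ·)` lies in `H`, and `F(x) = ⟨F, K(x, ·)⟩` for `F ∈ H` and every `x ∈ X`. -/
structure IsRKHSInL2 {X : Type*} [MeasurableSpace X] (μ : Measure X) (H : Set (X → ℍ[ℝ]))
    (K : X → X → ℍ[ℝ]) : Prop where
  memLp : ∀ F ∈ H, MemLp F 2 μ
  zero_mem : (fun _ => 0) ∈ H
  add_mem : ∀ F ∈ H, ∀ G ∈ H, (fun x => F x + G x) ∈ H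
  smul_mem : ∀ (c : ℍ[ℝ]), ∀ F ∈ H, (fun x => c * F x) ∈ H
  eq_of_ae_eq : ∀ F ∈ H, ∀ G ∈ H, F =ᵐ[μ] G → F = G
  isClosed : IsClosed {Φ : Lp ℍ[ℝ] 2 μ | ∃ F ∈ H, (Φ : X → ℍ[ℝ]) =ᵐ[μ] F}
  kernel_mem : ∀ x, K x ∈ H
  reproducing : ∀ F ∈ H, ∀ x,
    Integrable (fun y => F y * star (K x y)) μ ∧ F x = ∫ y, F y * star (K x y) ∂μ

end QShearlet

end

/-!
The convolution condition forces `ψ` to be a complex-valued function in disguise, and the theorem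
then reduces to the isometry property of the classical shearlet transform.

Write a quaternion as `q = q₁ + i q₂` with `q₁, q₂ ∈ ℝ + ℝj ≅ ℂ` (`fstComp`, `sndComp`). The
right-sided Fourier transform `∫ f(z) e^{-2πj w·z} dz` is the ordinary complex one in each
component. Since `i q = ∓ q j` on the ranges of the projections `P_± q = (q ± i q j) / 2`, the
two-sided transform is `F_Q f (u, v) = P_+ f^(-u, v) + P_- f^(u, v)`, where `f^` is the right-sided
transform (`twoSided`, `qftIntegral_eq_twoSided`, `IsRightFourier.qft_ae_eq`). The operation
`twoSided` is an involution, so `f^` can be recovered from `F_Q f`.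

The first half of the convolution condition says that `F_Q ψ` commutes with `j`, hence has values
in `ℝ + ℝj`; the second half says that `F_Q (jψ) = j F_Q ψ`, hence that `F_Q ψ` is even in `u`. It
follows that `ψ^ = F_Q ψ`, that `ψ` has values in `ℝ + ℝj`, and that `|F_Q (ψ*)| = |ψ^|`. So the
admissibility integral is the classical one of a complex shearlet
(`ConvolutionCondition.exists_fourier`), and the quaternion transform of `f` consists of the
complex shearlet transforms of the two components of `f`.

For the complex transform, Parseval's identity makes `t ↦ SH f (a, s, t)` the inverse Fourier
transform of the integrable function `f^ · conj (ψ_{a,s,0}^)`. Plancherel's identity in `t` (valid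
in `[0, ∞]` for every integrable function, `eLpNorm_fourierInv_of_integrable`), Tonelli's theorem
and a change of variables in `(a, s)` (`lintegral_dualPoint`) give `‖SH f‖² = C_ψ ‖f‖²`
(`lintegral_complexTransform`).

Thus `C_ψ^{-1/2} SH` is an isometry, which gives closedness of the range and the injectivity
modulo null sets. Polarization, together with left `ℍ`-linearity, yields
`∫ SH f · conj (SH g) dμ = C_ψ ⟨f, g⟩_Q` (`integral_shearletTransform_mul_star`); with `g = ψ_p`
this is the reproducing formula. The bound on the kernel is the Cauchy–Schwarz inequality, as
`‖ψ_p‖ = ‖ψ‖` (`eLpNorm_shearlet`).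
-/

noncomputable section

namespace QShearlet

open scoped FourierTransform SchwartzMap ContDiff

/-! ### The Fourier transform of square integrable functions -/

section L2Fourier

variable {E : Type*} [NormedAddCommGroup E] [InnerProductSpace ℝ E] [FiniteDimensional ℝ E]
  [MeasurableSpace E] [BorelSpace E]

/-- `g` represents the `L²` Fourier transform of the square integrable function `f`. -/
def IsL2Fourier (f g : E → ℂ) : Prop :=
  ∃ (hf : MemLp f 2 volume) (hg : MemLp g 2 volume), 𝓕 (hf.toLp f) = hg.toLp g

/-- Locally integrable functions that agree as tempered distributions agree almost everywhere. -/
lemma ae_eq_of_integral_schwartz_eq {f g : E → ℂ} (hf : LocallyIntegrable f)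
    (hg : LocallyIntegrable g) (h : ∀ φ : 𝓢(E, ℂ), ∫ x, φ x • f x = ∫ x, φ x • g x) :
    f =ᵐ[volume] g := by
  refine ae_eq_of_integral_contDiff_smul_eq hf hg fun φ hφ hc => ?_
  have hg₁ : HasCompactSupport (Complex.ofRealCLM ∘ φ) := hc.comp_left rfl
  have hg₂ : ContDiff ℝ ∞ (Complex.ofRealCLM ∘ φ) := by fun_prop
  have := h (hg₁.toSchwartzMap hg₂)
  simpa using this

lemma integral_fourier_smul_eq_smul_fourier {f : E → ℂ} (hf : Integrable f) (φ : 𝓢(E, ℂ)) :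
    ∫ x, 𝓕 φ x • f x = ∫ x, φ x • 𝓕 f x := by
  have := VectorFourier.integral_fourierIntegral_smul_eq_flip (μ := (volume : Measure E))
    (ν := (volume : Measure E)) (L := innerₗ E) (e := Real.fourierChar) (f := φ) (g := f)
    Real.continuous_fourierChar continuous_inner φ.integrable hf
  rw [flip_innerₗ] at this
  exact this

lemma continuous_fourier_of_integrable {f : E → ℂ} (hf : Integrable f) : Continuous (𝓕 f) :=
  VectorFourier.fourierIntegral_continuous Real.continuous_fourierChar
    (L := innerₗ E) continuous_inner hf

/-- The `L²` Fourier transform is adjoint to the Fourier transform of Schwartz functions, since it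
agrees with the Fourier transform of tempered distributions. -/
lemma IsL2Fourier.integral_smul_eq {f g : E → ℂ} (h : IsL2Fourier f g) (φ : 𝓢(E, ℂ)) :
    ∫ x, 𝓕 φ x • f x = ∫ x, φ x • g x := by
  obtain ⟨hf, hg, h⟩ := h
  have := congrArg (fun T : 𝓢'(E, ℂ) => T φ) (Lp.fourier_toTemperedDistribution_eq (hf.toLp f))
  simp only [TemperedDistribution.fourier_apply, Lp.toTemperedDistribution_apply] at this
  rw [h] at this
  refine Eq.trans ?_ (this.trans ?_) <;> apply integral_congr_ae
  · filter_upwards [hf.coeFn_toLp] with x hx; rw [hx]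
  · filter_upwards [hg.coeFn_toLp] with x hx; rw [hx]

lemma isL2Fourier_coeFn (f : Lp ℂ 2 (volume : Measure E)) :
    IsL2Fourier f (𝓕 f : Lp ℂ 2 (volume : Measure E)) :=
  ⟨Lp.memLp _, Lp.memLp _, by simp⟩

lemma IsL2Fourier.congr {f g f' g' : E → ℂ} (h : IsL2Fourier f g) (hf : f =ᵐ[volume] f')
    (hg : g =ᵐ[volume] g') : IsL2Fourier f' g' := by
  obtain ⟨h1, h2, h⟩ := h
  refine ⟨(memLp_congr_ae hf).1 h1, (memLp_congr_ae hg).1 h2, ?_⟩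
  rwa [← MemLp.toLp_congr h1 _ hf, ← MemLp.toLp_congr h2 _ hg]

lemma exists_isL2Fourier {f : E → ℂ} (hf : MemLp f 2 volume) :
    ∃ g, StronglyMeasurable g ∧ IsL2Fourier f g :=
  ⟨_, Lp.stronglyMeasurable _, (isL2Fourier_coeFn (hf.toLp f)).congr hf.coeFn_toLp .rfl⟩

lemma IsL2Fourier.ae_unique {f g g' : E → ℂ} (h : IsL2Fourier f g) (h' : IsL2Fourier f g') :
    g =ᵐ[volume] g' := by
  obtain ⟨h1, h2, h⟩ := h
  obtain ⟨h1', h2', h'⟩ := h'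
  exact (MemLp.toLp_eq_toLp_iff h2 h2').1 (h.symm.trans h')

lemma IsL2Fourier.eLpNorm_eq {f g : E → ℂ} (h : IsL2Fourier f g) :
    eLpNorm g 2 volume = eLpNorm f 2 volume := by
  obtain ⟨h1, h2, h⟩ := h
  have := Lp.norm_fourier_eq (h1.toLp f)
  rw [h, Lp.norm_toLp, Lp.norm_toLp] at this
  exact (ENNReal.toReal_eq_toReal_iff' h2.2.ne h1.2.ne).1 this

lemma IsL2Fourier.sub {f g f' g' : E → ℂ} (h : IsL2Fourier f g) (h' : IsL2Fourier f' g') :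
    IsL2Fourier (f - f') (g - g') := by
  obtain ⟨h1, h2, h⟩ := h
  obtain ⟨h1', h2', h'⟩ := h'
  refine ⟨h1.sub h1', h2.sub h2', ?_⟩
  rw [MemLp.toLp_sub h1 h1', MemLp.toLp_sub h2 h2', ← h, ← h']
  exact map_sub (Lp.fourierTransformₗᵢ E ℂ) _ _

lemma IsL2Fourier.const_smul {f g : E → ℂ} (h : IsL2Fourier f g) (c : ℂ) :
    IsL2Fourier (c • f) (c • g) := by
  obtain ⟨h1, h2, h⟩ := h
  refine ⟨h1.const_smul c, h2.const_smul c, ?_⟩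
  rw [MemLp.toLp_const_smul c h1, MemLp.toLp_const_smul c h2, ← h]
  exact map_smul (Lp.fourierTransformₗᵢ E ℂ) _ _

/-- Parseval's identity. -/
lemma IsL2Fourier.integral_mul_star_eq {f g f' g' : E → ℂ} (h : IsL2Fourier f g)
    (h' : IsL2Fourier f' g') : ∫ x, g x * star (g' x) = ∫ x, f x * star (f' x) := by
  obtain ⟨h1, h2, h⟩ := h
  obtain ⟨h1', h2', h'⟩ := h'
  have := Lp.inner_fourier_eq (h1'.toLp f') (h1.toLp f)
  rw [h, h', L2.inner_def, L2.inner_def] at this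
  refine Eq.trans ?_ (this.trans ?_) <;> apply integral_congr_ae
  · filter_upwards [h2.coeFn_toLp, h2'.coeFn_toLp] with x hx hx'
    rw [hx, hx']; simp [RCLike.inner_apply]
  · filter_upwards [h1.coeFn_toLp, h1'.coeFn_toLp] with x hx hx'
    rw [hx, hx']; simp [RCLike.inner_apply]

/-- On `L¹ ∩ L²` the `L²` Fourier transform is given by the Fourier integral. -/
lemma isL2Fourier_fourier {f : E → ℂ} (hf : Integrable f) (hf2 : MemLp f 2 volume) :
    IsL2Fourier f (𝓕 f) := by
  obtain ⟨g, -, hg⟩ := exists_isL2Fourier hf2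
  refine hg.congr .rfl (ae_eq_of_integral_schwartz_eq ?_ ?_ fun φ => ?_)
  · exact hg.2.1.locallyIntegrable one_le_two
  · exact (continuous_fourier_of_integrable hf).locallyIntegrable
  · rw [← hg.integral_smul_eq, integral_fourier_smul_eq_smul_fourier hf]

/-- An integrable function with square integrable Fourier transform is square integrable. -/
lemma memLp_two_of_fourier {f : E → ℂ} (hf : Integrable f) (hf2 : MemLp (𝓕 f) 2 volume) :
    MemLp f 2 volume := by
  have hg := isL2Fourier_coeFn (𝓕⁻ (hf2.toLp (𝓕 f)) : Lp ℂ 2 (volume : Measure E))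
  -- Test against `𝓕 (𝓕⁻ φ) = φ` and move one Fourier transform onto each side.
  have key : f =ᵐ[volume] (𝓕⁻ (hf2.toLp (𝓕 f)) : Lp ℂ 2 (volume : Measure E)) := by
    refine ae_eq_of_integral_schwartz_eq hf.locallyIntegrable
      (hg.1.locallyIntegrable one_le_two) fun φ => ?_
    have h1 := hg.integral_smul_eq (𝓕⁻ φ)
    have h2 := integral_fourier_smul_eq_smul_fourier hf (𝓕⁻ φ)
    rw [FourierTransform.fourier_fourierInv_eq] at h1 h2
    rw [h1, h2]
    apply integral_congr_ae
    rw [FourierTransform.fourier_fourierInv_eq]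
    filter_upwards [hf2.coeFn_toLp] with x hx
    rw [hx]
  exact (memLp_congr_ae key).2 hg.1

/-- Plancherel's identity for an integrable function, both sides being possibly infinite. -/
lemma eLpNorm_fourier_of_integrable {f : E → ℂ} (hf : Integrable f) :
    eLpNorm (𝓕 f) 2 volume = eLpNorm f 2 volume := by
  by_cases h : MemLp f 2 volume
  · exact (isL2Fourier_fourier hf h).eLpNorm_eq
  · have h' : ¬ MemLp (𝓕 f) 2 volume := fun h' => h (memLp_two_of_fourier hf h')
    have e1 : eLpNorm f 2 volume = ⊤ := by
      by_contra hne
      exact h ⟨hf.1, lt_top_iff_ne_top.2 hne⟩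
    have e2 : eLpNorm (𝓕 f) 2 volume = ⊤ := by
      by_contra hne
      exact h' ⟨(continuous_fourier_of_integrable hf).aestronglyMeasurable,
        lt_top_iff_ne_top.2 hne⟩
    rw [e1, e2]

lemma eLpNorm_fourierInv_of_integrable {f : E → ℂ} (hf : Integrable f) :
    eLpNorm (𝓕⁻ f) 2 volume = eLpNorm f 2 volume := by
  have h : (𝓕⁻ f) = (𝓕 f) ∘ (fun x => -x) := by
    ext x; exact Real.fourierInv_eq_fourier_neg f x
  rw [h, eLpNorm_comp_measurePreserving
    (continuous_fourier_of_integrable hf).aestronglyMeasurable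
    (Measure.measurePreserving_neg volume), eLpNorm_fourier_of_integrable hf]

end L2Fourier

/-! ### Truncation to balls -/

section Truncation

variable {E F : Type*} [NormedAddCommGroup E] [MeasurableSpace E] [BorelSpace E]
  [NormedAddCommGroup F] {μ : Measure E}

lemma MemLp.integrable_indicator_closedBall [ProperSpace E] [IsFiniteMeasureOnCompacts μ]
    {f : E → F} (hf : MemLp f 2 μ) (R : ℝ) :
    Integrable ((Metric.closedBall 0 R).indicator f) μ := by
  rw [integrable_indicator_iff Metric.isClosed_closedBall.measurableSet]
  have : IsFiniteMeasure (μ.restrict (Metric.closedBall (0 : E) R)) :=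
    ⟨by simpa using (isCompact_closedBall (0 : E) R).measure_lt_top⟩
  exact (hf.restrict _).integrable one_le_two

lemma tendsto_eLpNorm_indicator_closedBall_sub {f : E → F} (hf : MemLp f 2 μ) :
    Tendsto (fun R : ℕ => eLpNorm ((Metric.closedBall 0 (R : ℝ)).indicator f - f) 2 μ)
      atTop (𝓝 0) := by
  have e : ∀ R : ℕ, eLpNorm ((Metric.closedBall 0 (R : ℝ)).indicator f - f) 2 μ
      = (∫⁻ x, ((Metric.closedBall 0 (R : ℝ))ᶜ.indicator (fun x => ‖f x‖ₑ ^ 2) x) ∂μ)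
        ^ (1 / 2 : ℝ) := by
    intro R
    rw [eLpNorm_eq_lintegral_rpow_enorm_toReal (by simp) (by simp)]
    congr 1
    · refine lintegral_congr fun x => ?_
      by_cases hx : x ∈ Metric.closedBall (0 : E) (R : ℝ)
      · simp [hx]
      · simp [hx]
  simp_rw [e]
  have h0 : Tendsto (fun R : ℕ =>
      ∫⁻ x, ((Metric.closedBall 0 (R : ℝ))ᶜ.indicator (fun x => ‖f x‖ₑ ^ 2) x) ∂μ)
      atTop (𝓝 (∫⁻ _, 0 ∂μ)) := by
    refine tendsto_lintegral_of_dominated_convergence' (fun x => ‖f x‖ₑ ^ 2) ?_ ?_ ?_ ?_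
    · intro R
      exact (hf.1.enorm.pow_const 2).indicator Metric.isClosed_closedBall.measurableSet.compl
    · exact fun R => Eventually.of_forall fun x => Set.indicator_le_self _ _ _
    · have := hf.2
      rw [eLpNorm_lt_top_iff_lintegral_rpow_enorm_lt_top (by simp) (by simp)] at this
      simpa using this.ne
    · refine Eventually.of_forall fun x => ?_
      obtain ⟨N, hN⟩ := exists_nat_ge ‖x‖
      refine tendsto_const_nhds.congr' ?_
      filter_upwards [eventually_ge_atTop N] with R hR
      have : x ∈ Metric.closedBall (0 : E) (R : ℝ) := by
        simpa using hN.trans (by exact_mod_cast hR)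
      simp [this]
  have := (ENNReal.continuous_rpow_const (y := (1 / 2 : ℝ))).tendsto _ |>.comp h0
  simpa [Function.comp_def] using this

end Truncation

/-! ### Covariance of the `L²` Fourier transform -/

section Transfer

variable {E : Type*} [NormedAddCommGroup E] [InnerProductSpace ℝ E] [FiniteDimensional ℝ E]
  [MeasurableSpace E] [BorelSpace E]

lemma IsL2Fourier.tendsto_eLpNorm_fourier_indicator_sub {f g : E → ℂ} (h : IsL2Fourier f g) :
    Tendsto (fun R : ℕ => eLpNorm (𝓕 ((Metric.closedBall 0 (R : ℝ)).indicator f) - g) 2 volume)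
      atTop (𝓝 0) := by
  refine (tendsto_eLpNorm_indicator_closedBall_sub h.1).congr fun R => ?_
  exact (((isL2Fourier_fourier (MemLp.integrable_indicator_closedBall h.1 R)
    (h.1.indicator Metric.isClosed_closedBall.measurableSet)).sub h).eLpNorm_eq).symm

/-- The graph of the `L²` Fourier transform is closed. -/
lemma isL2Fourier_of_tendsto {f g : E → ℂ} (hf : MemLp f 2 volume) (hg : MemLp g 2 volume)
    {F G : ℕ → E → ℂ} (hFG : ∀ k, IsL2Fourier (F k) (G k))
    (hF : Tendsto (fun k => eLpNorm (F k - f) 2 volume) atTop (𝓝 0))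
    (hG : Tendsto (fun k => eLpNorm (G k - g) 2 volume) atTop (𝓝 0)) : IsL2Fourier f g := by
  refine ⟨hf, hg, ?_⟩
  have h1 := (Lp.tendsto_Lp_iff_tendsto_eLpNorm'' F (fun k => (hFG k).1) f hf).2 hF
  have h2 := (Lp.tendsto_Lp_iff_tendsto_eLpNorm'' G (fun k => (hFG k).2.1) g hg).2 hG
  have h3 := ((Lp.fourierTransformₗᵢ E ℂ).continuous.tendsto _).comp h1
  refine tendsto_nhds_unique h3 (h2.congr fun k => ?_)
  exact (hFG k).2.2.symm

/-- A covariance `𝓕 ∘ U = V ∘ 𝓕` that holds for Fourier integrals extends to the `L²` Fourier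
transform, provided `U` and `V` are additive and bounded for the `L²` norm. -/
lemma IsL2Fourier.transfer {f g : E → ℂ} (h : IsL2Fourier f g) (U V : (E → ℂ) → E → ℂ)
    (cU cV : ℝ≥0∞) (hcU : cU ≠ ⊤) (hcV : cV ≠ ⊤)
    (hU : ∀ f, MemLp f 2 volume → MemLp (U f) 2 volume)
    (hV : ∀ f, MemLp f 2 volume → MemLp (V f) 2 volume)
    (hUi : ∀ f, Integrable f volume → Integrable (U f) volume)
    (hUsub : ∀ f g, U (f - g) = U f - U g) (hVsub : ∀ f g, V (f - g) = V f - V g)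
    (hUn : ∀ f, MemLp f 2 volume → eLpNorm (U f) 2 volume ≤ cU * eLpNorm f 2 volume)
    (hVn : ∀ f, MemLp f 2 volume → eLpNorm (V f) 2 volume ≤ cV * eLpNorm f 2 volume)
    (hUV : ∀ f, Integrable f volume → 𝓕 (U f) = V (𝓕 f)) :
    IsL2Fourier (U f) (V g) := by
  have hfR : ∀ R : ℕ, MemLp ((Metric.closedBall 0 (R : ℝ)).indicator f) 2 volume := fun R =>
    h.1.indicator Metric.isClosed_closedBall.measurableSet
  have hfi : ∀ R : ℕ, Integrable ((Metric.closedBall 0 (R : ℝ)).indicator f) volume := fun R =>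
    MemLp.integrable_indicator_closedBall h.1 R
  have hgR : ∀ R : ℕ, MemLp (𝓕 ((Metric.closedBall 0 (R : ℝ)).indicator f)) 2 volume := fun R =>
    (isL2Fourier_fourier (hfi R) (hfR R)).2.1
  refine isL2Fourier_of_tendsto (hU _ h.1) (hV _ h.2.1)
    (F := fun R => U ((Metric.closedBall 0 (R : ℝ)).indicator f))
    (G := fun R => V (𝓕 ((Metric.closedBall 0 (R : ℝ)).indicator f))) ?_ ?_ ?_
  · intro R
    rw [← hUV _ (hfi R)]
    exact isL2Fourier_fourier (hUi _ (hfi R)) (hU _ (hfR R))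
  · have := ENNReal.Tendsto.const_mul (a := cU) (tendsto_eLpNorm_indicator_closedBall_sub h.1)
      (Or.inr hcU)
    rw [mul_zero] at this
    refine tendsto_of_tendsto_of_tendsto_of_le_of_le tendsto_const_nhds this
      (fun _ => zero_le) fun R => ?_
    dsimp only
    rw [← hUsub]
    exact hUn _ ((hfR R).sub h.1)
  · have := ENNReal.Tendsto.const_mul (a := cV) h.tendsto_eLpNorm_fourier_indicator_sub
      (Or.inr hcV)
    rw [mul_zero] at this
    refine tendsto_of_tendsto_of_tendsto_of_le_of_le tendsto_const_nhds this
      (fun _ => zero_le) fun R => ?_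
    dsimp only
    rw [← hVsub]
    exact hVn _ ((hgR R).sub h.2.1)

lemma IsL2Fourier.star_comp_neg {f g : E → ℂ} (h : IsL2Fourier f g) :
    IsL2Fourier (fun x => star (f (-x))) (fun x => star (g x)) := by
  have hneg := Measure.measurePreserving_neg (volume : Measure E)
  have hUm : ∀ {p : ℝ≥0∞} (f : E → ℂ), MemLp f p volume →
      MemLp (fun x => star (f (-x))) p volume := fun f hf =>
    (hf.comp_measurePreserving hneg).star
  refine h.transfer (fun f x => star (f (-x))) (fun g x => star (g x)) 1 1 (by simp) (by simp)
    (fun f => hUm f) (fun f hf => hf.star)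
    (fun f hf => memLp_one_iff_integrable.1 (hUm f (memLp_one_iff_integrable.2 hf)))
    (fun f g => by ext; simp) (fun f g => by ext; simp) (fun f hf => ?_) (fun f hf => ?_)
    (fun f hf => ?_)
  · rw [one_mul, ← eLpNorm_comp_measurePreserving hf.1 hneg]
    refine le_of_eq (eLpNorm_congr_norm_ae (Eventually.of_forall fun x => ?_))
    simp
  · rw [one_mul]
    refine le_of_eq (eLpNorm_congr_norm_ae (Eventually.of_forall fun x => ?_))
    simp
  · ext w
    rw [Real.fourier_eq', Real.fourier_eq', ← integral_neg_eq_self]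
    simp only [smul_eq_mul, neg_neg, inner_neg_left]
    rw [← starRingEnd_apply, ← integral_conj]
    refine integral_congr_ae (Eventually.of_forall fun x => ?_)
    simp [← Complex.exp_conj, Complex.conj_ofNat]

lemma map_linearEquiv_volume (L : E ≃ₗ[ℝ] E) :
    Measure.map L (volume : Measure E)
      = ENNReal.ofReal |(LinearMap.det (L : E →ₗ[ℝ] E))⁻¹| • volume :=
  Measure.map_linearMap_addHaar_eq_smul_addHaar volume (LinearEquiv.isUnit_det' L).ne_zero

lemma measurableEmbedding_linearEquiv (L : E ≃ₗ[ℝ] E) : MeasurableEmbedding L :=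
  L.toContinuousLinearEquiv.toHomeomorph.measurableEmbedding

lemma eLpNorm_comp_linearEquiv (L : E ≃ₗ[ℝ] E) (p : ℝ≥0∞) {F : Type*}
    [NormedAddCommGroup F] (f : E → F) :
    eLpNorm (fun x => f (L x)) p volume
      = ENNReal.ofReal |(LinearMap.det (L : E →ₗ[ℝ] E))⁻¹| ^ (1 / p).toReal
        • eLpNorm f p volume := by
  have h := (measurableEmbedding_linearEquiv L).eLpNorm_map_measure (g := f) (p := p)
    (μ := (volume : Measure E))
  have hc : ENNReal.ofReal |(LinearMap.det (L : E →ₗ[ℝ] E))⁻¹| ≠ 0 := by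
    simpa using (LinearEquiv.isUnit_det' L).ne_zero
  rw [map_linearEquiv_volume, eLpNorm_smul_measure_of_ne_zero hc] at h
  exact h.symm

lemma memLp_comp_linearEquiv (L : E ≃ₗ[ℝ] E) {p : ℝ≥0∞} {F : Type*} [NormedAddCommGroup F]
    {f : E → F} (hf : MemLp f p volume) : MemLp (fun x => f (L x)) p volume := by
  have : MemLp f p (Measure.map L (volume : Measure E)) := by
    rw [map_linearEquiv_volume]
    exact hf.smul_measure ENNReal.ofReal_ne_top
  exact ((measurableEmbedding_linearEquiv L).memLp_map_measure_iff).1 this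

lemma integral_comp_linearEquiv (L : E ≃ₗ[ℝ] E) {F : Type*} [NormedAddCommGroup F]
    [NormedSpace ℝ F] (f : E → F) :
    ∫ x, f (L x) = |(LinearMap.det (L : E →ₗ[ℝ] E))⁻¹| • ∫ x, f x := by
  rw [← (measurableEmbedding_linearEquiv L).integral_map, map_linearEquiv_volume,
    integral_smul_measure, ENNReal.toReal_ofReal (abs_nonneg _)]

/-- Behaviour of the `L²` Fourier transform under an invertible affine change of variables;
`L'` is the adjoint of the linear part `L`. -/
lemma IsL2Fourier.comp_affine {f g : E → ℂ} (h : IsL2Fourier f g) (L L' : E ≃ₗ[ℝ] E)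
    (hL : ∀ x y, inner ℝ (L x) y = inner ℝ x (L' y)) (t : E) :
    IsL2Fourier (fun x => f (L.symm (x - t)))
      (fun w => |LinearMap.det (L : E →ₗ[ℝ] E)|
        • (Complex.exp (↑(-2 * Real.pi * inner ℝ t w) * Complex.I) * g (L' w))) := by
  set d := |LinearMap.det (L : E →ₗ[ℝ] E)|
  have hsub := measurePreserving_sub_right (volume : Measure E) t
  have hUm : ∀ {p : ℝ≥0∞} (f : E → ℂ), MemLp f p volume →
      MemLp (fun x => f (L.symm (x - t))) p volume := fun f hf =>
    (memLp_comp_linearEquiv L.symm hf).comp_measurePreserving hsub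
  have hVc : Continuous fun w : E =>
      Complex.exp (↑(-2 * Real.pi * inner ℝ t w) * Complex.I) := by fun_prop
  have hVnorm : ∀ (g : E → ℂ) (w : E),
      ‖d • (Complex.exp (↑(-2 * Real.pi * inner ℝ t w) * Complex.I) * g (L' w))‖
        = ‖d • g (L' w)‖ := fun g w => by
    rw [norm_smul, norm_mul, Complex.norm_exp_ofReal_mul_I, one_mul, norm_smul]
  have hVm : ∀ (g : E → ℂ), MemLp g 2 volume → MemLp (fun w =>
      d • (Complex.exp (↑(-2 * Real.pi * inner ℝ t w) * Complex.I) * g (L' w))) 2 volume := by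
    intro g hg
    have hg' := (memLp_comp_linearEquiv L' hg).const_smul d
    refine hg'.congr_norm ?_ (Eventually.of_forall fun w => (hVnorm g w).symm)
    exact (hVc.aestronglyMeasurable.mul (memLp_comp_linearEquiv L' hg).1).const_smul d
  refine h.transfer (fun f x => f (L.symm (x - t))) (fun g w => d
        • (Complex.exp (↑(-2 * Real.pi * inner ℝ t w) * Complex.I) * g (L' w)))
    (ENNReal.ofReal |(LinearMap.det (L.symm : E →ₗ[ℝ] E))⁻¹| ^ ((1 / 2 : ℝ≥0∞)).toReal)
    (‖d‖ₑ * ENNReal.ofReal |(LinearMap.det (L' : E →ₗ[ℝ] E))⁻¹| ^ ((1 / 2 : ℝ≥0∞)).toReal)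
    (by finiteness) (by finiteness)
    (fun f => hUm f) hVm
    (fun f hf => memLp_one_iff_integrable.1 (hUm f (memLp_one_iff_integrable.2 hf)))
    (fun f g => by ext; simp) (fun f g => by ext; simp [mul_sub]) (fun f hf => ?_)
    (fun f hf => ?_) (fun f hf => ?_)
  · have := eLpNorm_comp_measurePreserving (memLp_comp_linearEquiv L.symm hf).1 hsub (p := 2)
    rw [Function.comp_def] at this
    rw [this, eLpNorm_comp_linearEquiv, smul_eq_mul]
  · rw [eLpNorm_congr_norm_ae (Eventually.of_forall (hVnorm f)), mul_assoc]
    have := eLpNorm_comp_linearEquiv L' 2 f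
    rw [smul_eq_mul] at this
    rw [← this]
    exact (eLpNorm_const_smul d (fun w => f (L' w)) 2 volume).le
  · ext w
    have e1 := integral_comp_linearEquiv L.symm
      (fun x => Complex.exp (↑(-2 * Real.pi * inner ℝ (L x) w) * Complex.I) • f x)
    rw [Real.fourier_eq', Real.fourier_eq',
      ← integral_add_right_eq_self _ t]
    simp only [add_sub_cancel_right]
    have hdet : |(LinearMap.det (L.symm : E →ₗ[ℝ] E))⁻¹| = d := by
      rw [LinearEquiv.det_coe_symm, inv_inv]
    simp only [hdet, LinearEquiv.apply_symm_apply] at e1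
    simp only [hL] at e1
    simp only [smul_eq_mul] at e1 ⊢
    rw [← mul_smul_comm, ← e1, ← integral_const_mul]
    refine integral_congr_ae (Eventually.of_forall fun x => ?_)
    simp only [inner_add_left]
    rw [← mul_assoc, ← Complex.exp_add]
    congr 2
    push_cast
    ring

end Transfer

/-! ### Quaternions as pairs of complex numbers -/

section Components

/-- The embedding of `ℂ` into the quaternions that sends `I` to `j`. -/
def ofComplexJ (z : ℂ) : ℍ[ℝ] := ⟨z.re, 0, z.im, 0⟩

/-- The component `q₁` in the decomposition `q = q₁ + i q₂` with `q₁, q₂ ∈ ℝ + ℝj ≅ ℂ`. -/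
def fstComp : ℍ[ℝ] →L[ℝ] ℂ :=
  LinearMap.toContinuousLinearMap
    { toFun := fun q => ⟨q.re, q.imJ⟩
      map_add' := fun _ _ => by apply Complex.ext <;> simp
      map_smul' := fun _ _ => by apply Complex.ext <;> simp }

/-- The component `q₂` in the decomposition `q = q₁ + i q₂` with `q₁, q₂ ∈ ℝ + ℝj ≅ ℂ`. -/
def sndComp : ℍ[ℝ] →L[ℝ] ℂ :=
  LinearMap.toContinuousLinearMap
    { toFun := fun q => ⟨q.imI, q.imK⟩
      map_add' := fun _ _ => by apply Complex.ext <;> simp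
      map_smul' := fun _ _ => by apply Complex.ext <;> simp }

/-- The quaternion `z + i w`, for `z, w ∈ ℝ + ℝj ≅ ℂ`. -/
def ofComps (z w : ℂ) : ℍ[ℝ] := ⟨z.re, w.re, z.im, w.im⟩

@[simp] lemma unitI_re : unitI.re = 0 := rfl
@[simp] lemma unitI_imI : unitI.imI = 1 := rfl
@[simp] lemma unitI_imJ : unitI.imJ = 0 := rfl
@[simp] lemma unitI_imK : unitI.imK = 0 := rfl
@[simp] lemma unitJ_re : unitJ.re = 0 := rfl
@[simp] lemma unitJ_imI : unitJ.imI = 0 := rfl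
@[simp] lemma unitJ_imJ : unitJ.imJ = 1 := rfl
@[simp] lemma unitJ_imK : unitJ.imK = 0 := rfl
@[simp] lemma ofComplexJ_re (z : ℂ) : (ofComplexJ z).re = z.re := rfl
@[simp] lemma ofComplexJ_imI (z : ℂ) : (ofComplexJ z).imI = 0 := rfl
@[simp] lemma ofComplexJ_imJ (z : ℂ) : (ofComplexJ z).imJ = z.im := rfl
@[simp] lemma ofComplexJ_imK (z : ℂ) : (ofComplexJ z).imK = 0 := rfl
@[simp] lemma ofComps_re (z w : ℂ) : (ofComps z w).re = z.re := rfl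
@[simp] lemma ofComps_imI (z w : ℂ) : (ofComps z w).imI = w.re := rfl
@[simp] lemma ofComps_imJ (z w : ℂ) : (ofComps z w).imJ = z.im := rfl
@[simp] lemma ofComps_imK (z w : ℂ) : (ofComps z w).imK = w.im := rfl

lemma fstComp_apply (q : ℍ[ℝ]) : fstComp q = ⟨q.re, q.imJ⟩ := rfl
lemma sndComp_apply (q : ℍ[ℝ]) : sndComp q = ⟨q.imI, q.imK⟩ := rfl

@[simp] lemma fstComp_ofComps (z w : ℂ) : fstComp (ofComps z w) = z := rfl
@[simp] lemma sndComp_ofComps (z w : ℂ) : sndComp (ofComps z w) = w := rfl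
@[simp] lemma fstComp_ofComplexJ (z : ℂ) : fstComp (ofComplexJ z) = z := rfl
@[simp] lemma sndComp_ofComplexJ (z : ℂ) : sndComp (ofComplexJ z) = 0 := rfl

lemma ofComps_fstComp_sndComp (q : ℍ[ℝ]) : ofComps (fstComp q) (sndComp q) = q := rfl

lemma ext_comps {p q : ℍ[ℝ]} (h1 : fstComp p = fstComp q) (h2 : sndComp p = sndComp q) :
    p = q := by
  rw [← ofComps_fstComp_sndComp p, h1, h2, ofComps_fstComp_sndComp]

lemma normSq_eq_comps (q : ℍ[ℝ]) : ‖q‖ ^ 2 = ‖fstComp q‖ ^ 2 + ‖sndComp q‖ ^ 2 := by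
  rw [sq ‖q‖, ← Quaternion.normSq_eq_norm_mul_self q, Complex.sq_norm, Complex.sq_norm,
    fstComp_apply, sndComp_apply, Quaternion.normSq_def', Complex.normSq_mk, Complex.normSq_mk]
  ring

lemma norm_ofComplexJ (z : ℂ) : ‖ofComplexJ z‖ = ‖z‖ := by
  have := normSq_eq_comps (ofComplexJ z)
  simp only [fstComp_ofComplexJ, sndComp_ofComplexJ, norm_zero] at this
  rw [← sq_eq_sq₀ (norm_nonneg _) (norm_nonneg _), this]
  ring

lemma norm_le_comps (q : ℍ[ℝ]) : ‖q‖ ≤ ‖fstComp q‖ + ‖sndComp q‖ := by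
  have := normSq_eq_comps q
  exact le_of_sq_le_sq
    (by nlinarith [mul_nonneg (norm_nonneg (fstComp q)) (norm_nonneg (sndComp q))]) (by positivity)

lemma enorm_sq_eq_comps (q : ℍ[ℝ]) : ‖q‖ₑ ^ 2 = ‖fstComp q‖ₑ ^ 2 + ‖sndComp q‖ₑ ^ 2 := by
  simp only [← ofReal_norm, ← ENNReal.ofReal_pow (norm_nonneg _), normSq_eq_comps q]
  exact ENNReal.ofReal_add (by positivity) (by positivity)

lemma continuous_ofComps : Continuous fun z : ℂ × ℂ => ofComps z.1 z.2 := by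
  have : (fun z : ℂ × ℂ => ofComps z.1 z.2) =
      LinearMap.toContinuousLinearMap
        ({ toFun := fun z => ofComps z.1 z.2
           map_add' := fun _ _ => by ext <;> simp
           map_smul' := fun _ _ => by ext <;> simp } : ℂ × ℂ →ₗ[ℝ] ℍ[ℝ]) := rfl
  rw [this]
  exact ContinuousLinearMap.continuous _

lemma continuous_ofComplexJ : Continuous ofComplexJ :=
  continuous_ofComps.comp (continuous_id.prodMk (continuous_const (y := (0 : ℂ))))

lemma memLp_iff_comps {X : Type*} [MeasurableSpace X] {μ : Measure X} {p : ℝ≥0∞}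
    {f : X → ℍ[ℝ]} :
    MemLp f p μ ↔ MemLp (fun x => fstComp (f x)) p μ ∧ MemLp (fun x => sndComp (f x)) p μ := by
  refine ⟨fun h => ⟨fstComp.comp_memLp' h, sndComp.comp_memLp' h⟩, fun h => ?_⟩
  refine (h.1.norm.add h.2.norm).mono
    (continuous_ofComps.comp_aestronglyMeasurable (h.1.1.prodMk h.2.1))
    (Eventually.of_forall fun x => ?_)
  exact (norm_le_comps (f x)).trans (le_abs_self _)

lemma eLpNorm_le_comps {X : Type*} [MeasurableSpace X] {μ : Measure X} {p : ℝ≥0∞} (hp : 1 ≤ p)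
    {f : X → ℍ[ℝ]} (hf : AEStronglyMeasurable f μ) :
    eLpNorm f p μ
      ≤ eLpNorm (fun x => fstComp (f x)) p μ + eLpNorm (fun x => sndComp (f x)) p μ := by
  have h1 := fstComp.continuous.comp_aestronglyMeasurable hf
  have h2 := sndComp.continuous.comp_aestronglyMeasurable hf
  calc eLpNorm f p μ ≤ eLpNorm ((fun x => ‖fstComp (f x)‖) + fun x => ‖sndComp (f x)‖) p μ :=
        eLpNorm_mono_real fun x => norm_le_comps (f x)
    _ ≤ _ := eLpNorm_add_le h1.norm h2.norm hp
    _ = _ := by rw [eLpNorm_norm, eLpNorm_norm]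

lemma exp_smul_of_norm_eq_one {u : ℍ[ℝ]} (hre : u.re = 0) (hu : ‖u‖ = 1) (r : ℝ) :
    NormedSpace.exp (r • u) = (Real.cos r : ℍ[ℝ]) + Real.sin r • u := by
  have hn : ‖r • u‖ = |r| := by rw [norm_smul, Real.norm_eq_abs, hu, mul_one]
  rw [Quaternion.exp_of_re_eq_zero _ (by simp [hre]), hn, Real.cos_abs, smul_smul]
  congr 2
  rcases lt_trichotomy r 0 with h | h | h
  · rw [abs_of_neg h, Real.sin_neg]
    field_simp [h.ne]
  · simp [h]
  · rw [abs_of_pos h]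
    field_simp [h.ne']

lemma norm_unitI : ‖unitI‖ = 1 := by
  have : ‖unitI‖ ^ 2 = 1 := by
    rw [normSq_eq_comps, fstComp_apply, sndComp_apply]
    simp [Complex.sq_norm, Complex.normSq_mk]
  exact (pow_eq_one_iff_of_nonneg (norm_nonneg _) two_ne_zero).1 this

lemma unitJ_eq : unitJ = ofComplexJ Complex.I := by ext <;> simp

lemma norm_unitJ : ‖unitJ‖ = 1 := by rw [unitJ_eq, norm_ofComplexJ, Complex.norm_I]

lemma fstComp_mul_ofComplexJ (q : ℍ[ℝ]) (z : ℂ) :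
    fstComp (q * ofComplexJ z) = fstComp q * z := by
  apply Complex.ext <;> simp [fstComp_apply]

lemma sndComp_mul_ofComplexJ (q : ℍ[ℝ]) (z : ℂ) :
    sndComp (q * ofComplexJ z) = sndComp q * z := by
  apply Complex.ext <;> simp [sndComp_apply]

lemma fstComp_unitJ_mul (q : ℍ[ℝ]) : fstComp (unitJ * q) = Complex.I * fstComp q := by
  apply Complex.ext <;> simp [fstComp_apply]

lemma sndComp_unitJ_mul (q : ℍ[ℝ]) : sndComp (unitJ * q) = -Complex.I * sndComp q := by
  apply Complex.ext <;> simp [sndComp_apply]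

lemma star_ofComplexJ (z : ℂ) : star (ofComplexJ z) = ofComplexJ (star z) := by
  ext <;> simp

lemma fstComp_star (q : ℍ[ℝ]) : fstComp (star q) = star (fstComp q) := by
  apply Complex.ext <;> simp [fstComp_apply]

lemma sndComp_star (q : ℍ[ℝ]) : sndComp (star q) = -sndComp q := by
  apply Complex.ext <;> simp [sndComp_apply]

/-- A quaternion commuting with `j` lies in `ℝ + ℝj`. -/
lemma sndComp_eq_zero_of_commute {q : ℍ[ℝ]} (h : q * unitJ = unitJ * q) : sndComp q = 0 := by
  have h1 := congrArg (fun q => sndComp q) h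
  simp only [sndComp_unitJ_mul] at h1
  rw [unitJ_eq, sndComp_mul_ofComplexJ] at h1
  have : (2 * Complex.I) * sndComp q = 0 := by linear_combination h1
  simpa using this

end Components

/-! ### Reflection in the first half of the variables -/

section HalfReflection

variable {n : ℕ}

/-- The reflection `(u, v) ↦ (-u, v)` of `ℝ²ⁿ`. -/
def halfReflection (n : ℕ) : Space (2 * n) ≃ₗᵢ[ℝ] Space (2 * n) :=
  LinearIsometryEquiv.piLpCongrRight 2 fun k =>
    if k.val < n then LinearIsometryEquiv.neg ℝ else LinearIsometryEquiv.refl ℝ ℝ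

lemma halfReflection_apply (w : Space (2 * n)) (k : Fin (2 * n)) :
    halfReflection n w k = if k.val < n then -w k else w k := by
  simp only [halfReflection, LinearIsometryEquiv.piLpCongrRight_apply]
  split_ifs <;> simp

@[simp] lemma halfReflection_halfReflection (w : Space (2 * n)) :
    halfReflection n (halfReflection n w) = w := by
  ext k
  simp only [halfReflection_apply]
  split_ifs <;> simp

@[simp] lemma fstHalf_halfReflection (w : Space (2 * n)) :
    fstHalf (halfReflection n w) = -fstHalf w := by
  ext k
  simp [fstHalf, halfReflection_apply]

@[simp] lemma sndHalf_halfReflection (w : Space (2 * n)) :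
    sndHalf (halfReflection n w) = sndHalf w := by
  ext k
  simp [sndHalf, halfReflection_apply]

lemma inner_eq_inner_halves (w z : Space (2 * n)) :
    inner ℝ w z = inner ℝ (fstHalf w) (fstHalf z) + inner ℝ (sndHalf w) (sndHalf z) := by
  simp only [PiLp.inner_apply, fstHalf, sndHalf]
  rw [← (finCongr (two_mul n).symm).sum_comp, Fin.sum_univ_add]
  rfl

lemma measurePreserving_halfReflection :
    MeasurePreserving (halfReflection n) volume volume :=
  (halfReflection n).measurePreserving

lemma ae_comp_halfReflection {p : Space (2 * n) → Prop} (h : ∀ᵐ w, p w) :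
    ∀ᵐ w, p (halfReflection n w) :=
  measurePreserving_halfReflection.quasiMeasurePreserving.ae h

end HalfReflection

/-! ### The two-sided quaternion Fourier transform -/

section TwoSided

variable {n : ℕ}

/-- The operator that turns the right-sided Fourier transform of a quaternion-valued function into
its two-sided one. With the projections `P_± q = (q ± i q j) / 2` onto the spaces of quaternions
satisfying `i q = ∓ q j`, it is `(u, v) ↦ P_+ h(-u, v) + P_- h(u, v)`. -/
def twoSided (h : Space (2 * n) → ℍ[ℝ]) (w : Space (2 * n)) : ℍ[ℝ] :=
  (1 / 2 : ℝ) • (h w + h (halfReflection n w))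
    + (1 / 2 : ℝ) • (unitI * (h (halfReflection n w) - h w) * unitJ)

lemma fstComp_twoSided (h : Space (2 * n) → ℍ[ℝ]) (w : Space (2 * n)) :
    fstComp (twoSided h w) = (1 / 2) * (fstComp (h w) + fstComp (h (halfReflection n w)))
      - Complex.I / 2 * (sndComp (h (halfReflection n w)) - sndComp (h w)) := by
  apply Complex.ext <;> simp [fstComp_apply, sndComp_apply, twoSided] <;> ring

lemma sndComp_twoSided (h : Space (2 * n) → ℍ[ℝ]) (w : Space (2 * n)) :
    sndComp (twoSided h w) = (1 / 2) * (sndComp (h w) + sndComp (h (halfReflection n w)))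
      + Complex.I / 2 * (fstComp (h (halfReflection n w)) - fstComp (h w)) := by
  apply Complex.ext <;> simp [fstComp_apply, sndComp_apply, twoSided] <;> ring

lemma twoSided_twoSided (h : Space (2 * n) → ℍ[ℝ]) (w : Space (2 * n)) :
    twoSided (twoSided h) w = h w := by
  have hI := Complex.I_mul_I
  apply ext_comps
  · rw [fstComp_twoSided]
    simp only [fstComp_twoSided, sndComp_twoSided, halfReflection_halfReflection]
    linear_combination (-(1 / 2) * (fstComp (h w) - fstComp (h (halfReflection n w)))) * hI
  · rw [sndComp_twoSided]
    simp only [fstComp_twoSided, sndComp_twoSided, halfReflection_halfReflection]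
    linear_combination (-(1 / 2) * (sndComp (h w) - sndComp (h (halfReflection n w)))) * hI

/-- Left multiplication by `j` exchanges `P_+` and `P_-`. -/
lemma twoSided_unitJ_mul (h : Space (2 * n) → ℍ[ℝ]) (w : Space (2 * n)) :
    twoSided (fun z => unitJ * h z) w = unitJ * twoSided h (halfReflection n w) := by
  apply ext_comps
  · simp only [fstComp_twoSided, fstComp_unitJ_mul, sndComp_unitJ_mul,
      halfReflection_halfReflection]
    ring
  · simp only [sndComp_twoSided, fstComp_unitJ_mul, sndComp_unitJ_mul,
      halfReflection_halfReflection]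
    ring

lemma twoSided_eq_self_of_even {h : Space (2 * n) → ℍ[ℝ]} {w : Space (2 * n)}
    (hw : h (halfReflection n w) = h w) : twoSided h w = h w := by
  rw [twoSided, hw, sub_self, mul_zero, zero_mul, smul_zero, add_zero, ← two_smul ℝ (h w),
    smul_smul]
  norm_num

lemma twoSided_sub (h h' : Space (2 * n) → ℍ[ℝ]) :
    twoSided (h - h') = twoSided h - twoSided h' := by
  ext1 w
  apply ext_comps
  · simp only [Pi.sub_apply, map_sub, fstComp_twoSided]; ring
  · simp only [Pi.sub_apply, map_sub, sndComp_twoSided]; ring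

lemma aestronglyMeasurable_twoSided {h : Space (2 * n) → ℍ[ℝ]}
    (hh : AEStronglyMeasurable h volume) : AEStronglyMeasurable (twoSided h) volume := by
  have h1 : AEStronglyMeasurable (fun w => h (halfReflection n w)) volume :=
    hh.comp_measurePreserving measurePreserving_halfReflection
  have h2 : AEStronglyMeasurable
      (fun w => unitI * (h (halfReflection n w) - h w) * unitJ) volume :=
    (aestronglyMeasurable_const.mul (h1.sub hh)).mul aestronglyMeasurable_const
  exact ((hh.add h1).const_smul (1 / 2 : ℝ)).add (h2.const_smul (1 / 2 : ℝ))

lemma norm_twoSided_le (h : Space (2 * n) → ℍ[ℝ]) (w : Space (2 * n)) :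
    ‖twoSided h w‖ ≤ ‖h w‖ + ‖h (halfReflection n w)‖ := by
  have h1 : ‖(1 / 2 : ℝ)‖ = 1 / 2 := by norm_num
  refine (norm_add_le _ _).trans ?_
  rw [norm_smul, norm_smul, norm_mul, norm_mul, norm_unitI, norm_unitJ, h1]
  have := norm_add_le (h w) (h (halfReflection n w))
  have := norm_sub_le (h (halfReflection n w)) (h w)
  linarith

lemma eLpNorm_twoSided_le {h : Space (2 * n) → ℍ[ℝ]} (hh : AEStronglyMeasurable h volume) :
    eLpNorm (twoSided h) 2 volume ≤ 2 * eLpNorm h 2 volume := by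
  have h1 : AEStronglyMeasurable (fun w => h (halfReflection n w)) volume :=
    hh.comp_measurePreserving measurePreserving_halfReflection
  calc eLpNorm (twoSided h) 2 volume
      ≤ eLpNorm ((fun w => ‖h w‖) + fun w => ‖h (halfReflection n w)‖) 2 volume :=
        eLpNorm_mono_real (norm_twoSided_le h)
    _ ≤ _ := eLpNorm_add_le hh.norm h1.norm one_le_two
    _ = 2 * eLpNorm h 2 volume := by
      have := eLpNorm_comp_measurePreserving (p := 2) hh measurePreserving_halfReflection
      rw [Function.comp_def] at this
      rw [eLpNorm_norm, eLpNorm_norm, this]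
      exact (two_mul _).symm

lemma memLp_twoSided {h : Space (2 * n) → ℍ[ℝ]} (hh : MemLp h 2 volume) :
    MemLp (twoSided h) 2 volume :=
  ⟨aestronglyMeasurable_twoSided hh.1, (eLpNorm_twoSided_le hh.1).trans_lt
    (ENNReal.mul_lt_top (by simp) hh.2)⟩

/-- The right-sided Fourier integral `w ↦ ∫ f(z) e^{-2πj w·z} dz`, in components. -/
def rightFourier (f : Space (2 * n) → ℍ[ℝ]) (w : Space (2 * n)) : ℍ[ℝ] :=
  ofComps (𝓕 (fun z => fstComp (f z)) w) (𝓕 (fun z => sndComp (f z)) w)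

lemma expI_eq (u x : Space n) :
    expI u x = ofComps (Real.cos (2 * Real.pi * inner ℝ u x) : ℝ)
      (-Real.sin (2 * Real.pi * inner ℝ u x) : ℝ) := by
  rw [expI, exp_smul_of_norm_eq_one unitI_re norm_unitI, Real.cos_neg, Real.sin_neg]
  ext <;> simp [-Complex.ofReal_cos, -Complex.ofReal_sin, -Complex.ofReal_neg]

lemma expJ_eq (v y : Space n) :
    expJ v y = ofComplexJ ⟨Real.cos (2 * Real.pi * inner ℝ v y),
      -Real.sin (2 * Real.pi * inner ℝ v y)⟩ := by
  rw [expJ, exp_smul_of_norm_eq_one unitJ_re norm_unitJ, Real.cos_neg, Real.sin_neg]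
  ext <;> simp

lemma cexp_eq_mk (r : ℝ) : Complex.exp (r * Complex.I) = ⟨Real.cos r, Real.sin r⟩ := by
  apply Complex.ext
  · simp [Complex.exp_ofReal_mul_I_re]
  · simp [Complex.exp_ofReal_mul_I_im]

/-- The kernel identity behind `qftIntegral_eq_twoSided`. -/
lemma comps_expI_mul_expJ (q : ℍ[ℝ]) (w z : Space (2 * n)) :
    let e := Complex.exp (↑(-2 * Real.pi * inner ℝ z w) * Complex.I)
    let e' := Complex.exp (↑(-2 * Real.pi * inner ℝ z (halfReflection n w)) * Complex.I)
    fstComp (expI (fstHalf w) (fstHalf z) * q * expJ (sndHalf w) (sndHalf z))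
        = (1 / 2) * (e • fstComp q + e' • fstComp q)
          - Complex.I / 2 * (e' • sndComp q - e • sndComp q) ∧
      sndComp (expI (fstHalf w) (fstHalf z) * q * expJ (sndHalf w) (sndHalf z))
        = (1 / 2) * (e • sndComp q + e' • sndComp q)
          + Complex.I / 2 * (e' • fstComp q - e • fstComp q) := by
  intro e e'
  have he : e = _ := cexp_eq_mk _
  have he' : e' = _ := cexp_eq_mk _
  rw [real_inner_comm, inner_eq_inner_halves] at he he'
  simp only [fstHalf_halfReflection, sndHalf_halfReflection, inner_neg_left] at he'
  rw [he, he', expI_eq, expJ_eq]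
  set α := 2 * Real.pi * inner ℝ (fstHalf w) (fstHalf z) with hα
  set β := 2 * Real.pi * inner ℝ (sndHalf w) (sndHalf z) with hβ
  have e1 : -2 * Real.pi * (inner ℝ (fstHalf w) (fstHalf z) + inner ℝ (sndHalf w) (sndHalf z))
      = -(α + β) := by rw [hα, hβ]; ring
  have e2 : -2 * Real.pi * (-inner ℝ (fstHalf w) (fstHalf z) + inner ℝ (sndHalf w) (sndHalf z))
      = α - β := by rw [hα, hβ]; ring
  rw [e1, e2, Real.cos_neg, Real.sin_neg, Real.cos_add, Real.sin_add, Real.cos_sub, Real.sin_sub]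
  constructor <;> apply Complex.ext <;>
    simp [fstComp_apply, sndComp_apply, -Complex.ofReal_cos, -Complex.ofReal_sin,
      -Complex.ofReal_neg] <;> ring

lemma continuous_fstHalf : Continuous (fstHalf : Space (2 * n) → Space n) := by
  unfold fstHalf; fun_prop

lemma continuous_sndHalf : Continuous (sndHalf : Space (2 * n) → Space n) := by
  unfold sndHalf; fun_prop

lemma norm_expI (u x : Space n) : ‖expI u x‖ = 1 := by
  have : ‖expI u x‖ ^ 2 = 1 := by
    rw [normSq_eq_comps, expI_eq, fstComp_ofComps, sndComp_ofComps, Complex.norm_real,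
      Complex.norm_real, Real.norm_eq_abs, Real.norm_eq_abs, sq_abs, sq_abs, neg_sq,
      Real.cos_sq_add_sin_sq]
  exact (pow_eq_one_iff_of_nonneg (norm_nonneg _) two_ne_zero).1 this

lemma norm_expJ (v y : Space n) : ‖expJ v y‖ = 1 := by
  have : ‖expJ v y‖ ^ 2 = 1 := by
    rw [expJ_eq, norm_ofComplexJ, Complex.sq_norm, Complex.normSq_mk, neg_mul_neg,
      ← sq, ← sq, Real.cos_sq_add_sin_sq]
  exact (pow_eq_one_iff_of_nonneg (norm_nonneg _) two_ne_zero).1 this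

lemma integrable_qft_integrand {f : Space (2 * n) → ℍ[ℝ]} (hf : Integrable f)
    (w : Space (2 * n)) :
    Integrable fun z => expI (fstHalf w) (fstHalf z) * f z * expJ (sndHalf w) (sndHalf z) := by
  refine hf.congr' ?_ (Eventually.of_forall fun z => ?_)
  · have h1 : Continuous fun z : Space (2 * n) => expI (fstHalf w) (fstHalf z) := by
      have := continuous_fstHalf (n := n)
      simp_rw [expI_eq]
      exact continuous_ofComps.comp (Continuous.prodMk
        (Complex.continuous_ofReal.comp (by fun_prop))
        (Complex.continuous_ofReal.comp (by fun_prop)))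
    have h2 : Continuous fun z : Space (2 * n) => expJ (sndHalf w) (sndHalf z) := by
      have := continuous_sndHalf (n := n)
      simp_rw [expJ_eq]
      exact continuous_ofComplexJ.comp <| Complex.equivRealProdCLM.symm.continuous.comp
        (Continuous.prodMk (by fun_prop) (by fun_prop))
    exact (h1.aestronglyMeasurable.mul hf.1).mul h2.aestronglyMeasurable
  · rw [norm_mul, norm_mul, norm_expI, norm_expJ, one_mul, mul_one]

lemma integrable_fourier_integrand {f : Space (2 * n) → ℂ} (hf : Integrable f)
    (w : Space (2 * n)) :
    Integrable fun z => Complex.exp (↑(-2 * Real.pi * inner ℝ z w) * Complex.I) • f z := by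
  refine hf.congr' ?_ (Eventually.of_forall fun z => ?_)
  · have : Continuous fun z : Space (2 * n) =>
        Complex.exp (↑(-2 * Real.pi * inner ℝ z w) * Complex.I) := by fun_prop
    exact this.aestronglyMeasurable.smul hf.1
  · rw [norm_smul, Complex.norm_exp_ofReal_mul_I, one_mul]

/-- The two-sided Fourier integral in terms of the right-sided one. -/
lemma qftIntegral_eq_twoSided {f : Space (2 * n) → ℍ[ℝ]} (hf : Integrable f) :
    qftIntegral f = twoSided (rightFourier f) := by
  ext1 w
  have h1 : Integrable fun z => fstComp (f z) := fstComp.integrable_comp hf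
  have h2 : Integrable fun z => sndComp (f z) := sndComp.integrable_comp hf
  have hc1 : ∀ w', _ := integrable_fourier_integrand h1
  have hc2 : ∀ w', _ := integrable_fourier_integrand h2
  have hq := integrable_qft_integrand hf w
  apply ext_comps
  · rw [fstComp_twoSided]
    simp only [rightFourier, fstComp_ofComps, sndComp_ofComps, Real.fourier_eq']
    have i1 := ((hc1 w).add (hc1 (halfReflection n w))).const_mul (1 / 2)
    have i2 := ((hc2 (halfReflection n w)).sub (hc2 w)).const_mul (Complex.I / 2)
    simp only [Pi.add_apply, Pi.sub_apply] at i1 i2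
    rw [← integral_add (hc1 w) (hc1 _), ← integral_sub (hc2 _) (hc2 w), ← integral_const_mul,
      ← integral_const_mul, ← integral_sub i1 i2, qftIntegral, ← fstComp.integral_comp_comm hq]
    exact integral_congr_ae (Eventually.of_forall fun z => (comps_expI_mul_expJ (f z) w z).1)
  · rw [sndComp_twoSided]
    simp only [rightFourier, fstComp_ofComps, sndComp_ofComps, Real.fourier_eq']
    have i1 := ((hc2 w).add (hc2 (halfReflection n w))).const_mul (1 / 2)
    have i2 := ((hc1 (halfReflection n w)).sub (hc1 w)).const_mul (Complex.I / 2)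
    simp only [Pi.add_apply, Pi.sub_apply] at i1 i2
    rw [← integral_add (hc2 w) (hc2 _), ← integral_sub (hc1 _) (hc1 w), ← integral_const_mul,
      ← integral_const_mul, ← integral_add i1 i2, qftIntegral, ← sndComp.integral_comp_comm hq]
    exact integral_congr_ae (Eventually.of_forall fun z => (comps_expI_mul_expJ (f z) w z).2)

/-- `h` represents the right-sided quaternion `L²` Fourier transform of `f`. -/
def IsRightFourier (f h : Space (2 * n) → ℍ[ℝ]) : Prop :=
  IsL2Fourier (fun z => fstComp (f z)) (fun w => fstComp (h w)) ∧
    IsL2Fourier (fun z => sndComp (f z)) (fun w => sndComp (h w))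

lemma IsRightFourier.memLp {f h : Space (2 * n) → ℍ[ℝ]} (H : IsRightFourier f h) :
    MemLp h 2 volume :=
  memLp_iff_comps.2 ⟨H.1.2.1, H.2.2.1⟩

lemma IsRightFourier.unitJ_mul {f h : Space (2 * n) → ℍ[ℝ]} (H : IsRightFourier f h) :
    IsRightFourier (fun z => unitJ * f z) (fun w => unitJ * h w) := by
  have h1 := H.1.const_smul Complex.I
  have h2 := H.2.const_smul (-Complex.I)
  constructor
  · simp only [fstComp_unitJ_mul]; exact h1
  · simp only [sndComp_unitJ_mul]; exact h2

lemma qftIntegral_memLp {f : Space (2 * n) → ℍ[ℝ]} (hf : Integrable f) (hf2 : MemLp f 2 volume) :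
    MemLp (qftIntegral f) 2 volume := by
  rw [qftIntegral_eq_twoSided hf]
  refine memLp_twoSided (IsRightFourier.memLp (f := f) ⟨?_, ?_⟩)
  · exact isL2Fourier_fourier (fstComp.integrable_comp hf) (memLp_iff_comps.1 hf2).1
  · exact isL2Fourier_fourier (sndComp.integrable_comp hf) (memLp_iff_comps.1 hf2).2

/-- Plancherel's theorem for the two-sided transform: the defining `L²` limit exists. -/
lemma IsRightFourier.isQFT {f h : Space (2 * n) → ℍ[ℝ]} (hf : MemLp f 2 volume)
    (H : IsRightFourier f h) : IsQFT f (twoSided h) := by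
  refine ⟨memLp_twoSided H.memLp, ?_⟩
  set B : ℕ → Set (Space (2 * n)) := fun R => Metric.closedBall 0 (R : ℝ)
  have hfi : ∀ R, Integrable ((B R).indicator f) := fun R =>
    MemLp.integrable_indicator_closedBall hf R
  have hf2 : ∀ R, MemLp ((B R).indicator f) 2 volume := fun R =>
    hf.indicator Metric.isClosed_closedBall.measurableSet
  have hr : ∀ R, MemLp (rightFourier ((B R).indicator f)) 2 volume := fun R =>
    IsRightFourier.memLp (f := (B R).indicator f)
      ⟨isL2Fourier_fourier (fstComp.integrable_comp (hfi R)) (memLp_iff_comps.1 (hf2 R)).1,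
        isL2Fourier_fourier (sndComp.integrable_comp (hfi R)) (memLp_iff_comps.1 (hf2 R)).2⟩
  have e1 := H.1.tendsto_eLpNorm_fourier_indicator_sub
  have e2 := H.2.tendsto_eLpNorm_fourier_indicator_sub
  have e := ENNReal.Tendsto.const_mul (a := 2) (e1.add e2) (Or.inr (by simp))
  rw [add_zero, mul_zero] at e
  refine tendsto_of_tendsto_of_tendsto_of_le_of_le tendsto_const_nhds e (fun _ => zero_le)
    fun R => ?_
  have h1 : (fun w => qftIntegral ((B R).indicator f) w - twoSided h w)
      = twoSided (rightFourier ((B R).indicator f) - h) := by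
    rw [twoSided_sub, qftIntegral_eq_twoSided (hfi R)]; rfl
  have hm := ((hr R).sub H.memLp).1
  have i1 : (fun z => fstComp ((B R).indicator f z)) = (B R).indicator fun z => fstComp (f z) :=
    (Set.indicator_comp_of_zero (f := f) (s := B R) (map_zero fstComp)).symm
  have i2 : (fun z => sndComp ((B R).indicator f z)) = (B R).indicator fun z => sndComp (f z) :=
    (Set.indicator_comp_of_zero (f := f) (s := B R) (map_zero sndComp)).symm
  dsimp only
  rw [h1]
  refine (eLpNorm_twoSided_le hm).trans ?_
  gcongr
  refine (eLpNorm_le_comps one_le_two hm).trans (le_of_eq ?_)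
  simp only [Pi.sub_apply, map_sub, rightFourier, fstComp_ofComps, sndComp_ofComps, i1, i2]
  rfl

lemma IsQFT.ae_unique {f g g' : Space (2 * n) → ℍ[ℝ]} (hf : MemLp f 2 volume) (h : IsQFT f g)
    (h' : IsQFT f g') : g =ᵐ[volume] g' := by
  have hq : ∀ R : ℕ, MemLp (qftIntegral ((Metric.closedBall 0 (R : ℝ)).indicator f)) 2 volume :=
    fun R => qftIntegral_memLp (MemLp.integrable_indicator_closedBall hf R)
      (hf.indicator Metric.isClosed_closedBall.measurableSet)
  have e := h'.2.add h.2
  rw [add_zero] at e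
  have : eLpNorm (g - g') 2 volume ≤ 0 := by
    refine ge_of_tendsto' e fun R => ?_
    have : g - g' = (fun w => qftIntegral ((Metric.closedBall 0 (R : ℝ)).indicator f) w - g' w)
        - (fun w => qftIntegral ((Metric.closedBall 0 (R : ℝ)).indicator f) w - g w) := by
      ext1 w; simp
    rw [this]
    exact eLpNorm_sub_le ((hq R).1.sub h'.1.1) ((hq R).1.sub h.1.1) one_le_two
  have h0 := (eLpNorm_eq_zero_iff (h.1.1.sub h'.1.1) two_ne_zero).1 (le_antisymm this zero_le)
  filter_upwards [h0] with w hw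
  exact sub_eq_zero.1 hw

/-- The quaternion Fourier transform of an `L²` function, in terms of its right-sided one. -/
lemma IsRightFourier.qft_ae_eq {f h : Space (2 * n) → ℍ[ℝ]} (hf : MemLp f 2 volume)
    (H : IsRightFourier f h) : qft f =ᵐ[volume] twoSided h :=
  IsQFT.ae_unique hf (Classical.epsilon_spec ⟨_, H.isQFT hf⟩) (H.isQFT hf)

end TwoSided

/-! ### Consequences of the convolution condition -/

section ConvolutionCondition

lemma ae_apply_ne_zero {d : ℕ} (k : Fin d) : ∀ᵐ w : Space d, w k ≠ 0 := by
  have h : ∀ᵐ x : Fin d → ℝ, x k ≠ 0 := by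
    have := Measure.pi_hyperplane (fun _ : Fin d => (volume : Measure ℝ)) k 0
    rw [← volume_pi] at this
    exact measure_eq_zero_iff_ae_notMem.1 this
  exact (PiLp.volume_preserving_ofLp (Fin d)).quasiMeasurePreserving.ae h

variable {n : ℕ} [NeZero n]

/-- If `q` commutes with `e^{-2πj v·t}` for enough `t`, and `v ≠ 0`, then `q` commutes with `j`. -/
lemma commute_unitJ_of_commute_expJ {q : ℍ[ℝ]} {v : Space n} (hv : v 0 ≠ 0)
    (h : ∀ k : ℕ, q * expJ v (EuclideanSpace.single 0 (1 / ((k : ℝ) + 1)))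
      = expJ v (EuclideanSpace.single 0 (1 / ((k : ℝ) + 1))) * q) : q * unitJ = unitJ * q := by
  -- Choose `t` so small that `0 < |2π v·t| < π`, whence `sin (2π v·t) ≠ 0`.
  obtain ⟨k, hk⟩ := exists_nat_gt (2 * |v 0|)
  have hk1 : (0 : ℝ) < k + 1 := by positivity
  have hin : inner ℝ v (EuclideanSpace.single (0 : Fin n) (1 / ((k : ℝ) + 1))) = v 0 / (k + 1) := by
    simp [EuclideanSpace.inner_single_right]
    ring
  set θ := 2 * Real.pi * (v 0 / (k + 1)) with hθ
  have hsin : Real.sin θ ≠ 0 := by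
    have hθ0 : θ ≠ 0 := by
      have := Real.pi_pos.ne'
      rw [hθ]; positivity
    have hθ1 : |θ| < Real.pi := by
      rw [hθ, abs_mul, abs_div, abs_of_pos hk1, abs_of_pos Real.two_pi_pos,
        ← mul_div_assoc, div_lt_iff₀ hk1]
      nlinarith [Real.pi_pos, abs_nonneg (v 0)]
    obtain ⟨h1, h2⟩ := abs_lt.1 hθ1
    rcases lt_or_gt_of_ne hθ0 with h' | h'
    · exact (Real.sin_neg_of_neg_of_neg_pi_lt h' h1).ne
    · exact (Real.sin_pos_of_pos_of_lt_pi h' h2).ne'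
  have h0 := h k
  have he : ∀ p : ℝ × ℝ, ofComplexJ ⟨p.1, p.2⟩ = (p.1 : ℍ[ℝ]) + p.2 • unitJ := fun p => by
    ext <;> simp
  rw [expJ_eq, hin, he (_, _)] at h0
  dsimp only at h0
  rw [mul_add, add_mul, (Quaternion.coe_commutes _ q).symm, add_right_inj, mul_smul_comm,
    smul_mul_assoc] at h0
  exact smul_right_injective ℍ[ℝ] (neg_ne_zero.2 hsin) h0

/-- The convolution condition says that the right-sided Fourier transform of `ψ` takes values in
`ℝ + ℝj` and is even in its first half of variables. -/
lemma ConvolutionCondition.right_fourier {ψ h : Space (2 * n) → ℍ[ℝ]} (hψ : MemLp ψ 2 volume)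
    (hc : ConvolutionCondition ψ) (H : IsRightFourier ψ h) :
    (∀ᵐ w, sndComp (h w) = 0) ∧ ∀ᵐ w, h (halfReflection n w) = h w := by
  have hq := H.qft_ae_eq hψ
  have hjm : MemLp (fun z => unitJ * ψ z) 2 volume :=
    memLp_iff_comps.2 ⟨H.unitJ_mul.1.1, H.unitJ_mul.2.1⟩
  have hqj := H.unitJ_mul.qft_ae_eq hjm
  set g := twoSided h with hg
  have hv := ae_apply_ne_zero (⟨n + 0, by have := NeZero.pos n; omega⟩ : Fin (2 * n))
  -- The values of `g` commute with `j`.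
  have hcomm : ∀ᵐ w, g w * unitJ = unitJ * g w := by
    have := ae_all_iff.2 fun k : ℕ => (hc (EuclideanSpace.single 0 (1 / ((k : ℝ) + 1)))).1
    filter_upwards [this, hq, hv] with w h1 h2 h3
    rw [h2] at h1
    exact commute_unitJ_of_commute_expJ (v := sndHalf w) h3 h1
  -- The second condition, at `t = 0`, says that `g` is even.
  have heven : ∀ᵐ w, g (halfReflection n w) = g w := by
    filter_upwards [(hc 0).2, hq, hqj] with w h1 h2 h3
    have he : expJ (sndHalf w) (0 : Space n) = 1 := by
      rw [expJ_eq]; ext <;> simp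
    rw [he, mul_one, mul_one, h2, h3, twoSided_unitJ_mul] at h1
    have hJ : unitJ ≠ 0 := fun h0 => by simpa [h0] using norm_unitJ
    exact mul_left_cancel₀ hJ h1
  have hhg : ∀ᵐ w, h w = g w := by
    filter_upwards [heven] with w hw
    rw [← twoSided_twoSided h w, ← hg, twoSided_eq_self_of_even hw]
  constructor
  · filter_upwards [hhg, hcomm] with w h1 h2
    rw [h1]
    exact sndComp_eq_zero_of_commute h2
  · filter_upwards [hhg, ae_comp_halfReflection hhg, heven] with w h1 h2 h3
    rw [h1, h2, h3]

lemma isL2Fourier_zero {d : ℕ} : IsL2Fourier (fun _ : Space d => (0 : ℂ)) fun _ => 0 := by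
  obtain ⟨g, -, hg⟩ := exists_isL2Fourier (f := fun _ : Space d => (0 : ℂ)) MemLp.zero'
  simpa using! hg.sub hg

/-- Under the convolution condition `ψ` takes values in `ℝ + ℝj ≅ ℂ`, and the admissibility integral
is the classical one for the ordinary Fourier transform `g` of this complex-valued function. -/
lemma ConvolutionCondition.exists_fourier {ψ : Space (2 * n) → ℍ[ℝ]} (hψ : MemLp ψ 2 volume)
    (hc : ConvolutionCondition ψ) :
    (∀ᵐ z, sndComp (ψ z) = 0) ∧ ∃ g : Space (2 * n) → ℂ, StronglyMeasurable g ∧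
      IsL2Fourier (fun z => fstComp (ψ z)) g ∧
      admissibilityIntegral ψ = ∫⁻ w : Space (2 * n), ‖g w‖ₑ ^ 2 /
        ENNReal.ofReal (|w ⟨0, Nat.mul_pos two_pos (NeZero.pos n)⟩| ^ (2 * n)) := by
  obtain ⟨g, hgm, hg⟩ := exists_isL2Fourier (memLp_iff_comps.1 hψ).1
  obtain ⟨g₂, -, hg₂⟩ := exists_isL2Fourier (memLp_iff_comps.1 hψ).2
  have H : IsRightFourier ψ fun w => ofComps (g w) (g₂ w) := ⟨hg, hg₂⟩
  obtain ⟨h1, h2⟩ := hc.right_fourier hψ H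
  simp only [sndComp_ofComps] at h1
  have hψ2 : ∀ᵐ z, sndComp (ψ z) = 0 := by
    have e := hg₂.eLpNorm_eq
    rw [eLpNorm_congr_ae (g := 0) h1, eLpNorm_zero] at e
    exact (eLpNorm_eq_zero_iff hg₂.1.1 two_ne_zero).1 e.symm
  refine ⟨hψ2, g, hgm, hg, ?_⟩
  have hneg := Measure.measurePreserving_neg (volume : Measure (Space (2 * n)))
  -- `ψ*` is again `ℝ + ℝj`-valued, and `g` is even, so that its two-sided transform is `conj g`.
  have H' : IsRightFourier (reflConj ψ) fun w => ofComplexJ (star (g w)) := by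
    constructor
    · simp only [reflConj, fstComp_star, fstComp_ofComplexJ]
      exact hg.star_comp_neg
    · simp only [reflConj, sndComp_star, sndComp_ofComplexJ]
      refine isL2Fourier_zero.congr ?_ .rfl
      filter_upwards [hneg.quasiMeasurePreserving.ae hψ2] with z hz
      rw [hz, neg_zero]
  have hm : MemLp (reflConj ψ) 2 volume := memLp_iff_comps.2 ⟨H'.1.1, H'.2.1⟩
  have hq := H'.qft_ae_eq hm
  refine lintegral_congr_ae ?_
  filter_upwards [hq, h2] with w hw1 hw2
  have hw3 : g (halfReflection n w) = g w := by
    simpa using congrArg (fun q => fstComp q) hw2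
  rw [hw1, twoSided_eq_self_of_even (by rw [hw3]), ← ofReal_norm, norm_ofComplexJ, norm_star,
    ofReal_norm]

end ConvolutionCondition

/-! ### Shear and dilation matrices -/

section Matrices

/-- The linear automorphism of `ℝ^d` given by an invertible matrix. -/
def matrixEquiv {d : ℕ} (M : Matrix (Fin d) (Fin d) ℝ) (hM : IsUnit M.det) :
    Space d ≃ₗ[ℝ] Space d :=
  LinearEquiv.ofLinearMap (Matrix.toLpLin 2 2 M) (Matrix.toLpLin 2 2 M⁻¹)
    (by rw [← Matrix.toLpLin_mul_same, Matrix.mul_nonsing_inv _ hM, Matrix.toLpLin_one])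
    (by rw [← Matrix.toLpLin_mul_same, Matrix.nonsing_inv_mul _ hM, Matrix.toLpLin_one])

lemma det_matrixEquiv {d : ℕ} (M : Matrix (Fin d) (Fin d) ℝ) (hM : IsUnit M.det) :
    LinearMap.det (matrixEquiv M hM : Space d →ₗ[ℝ] Space d) = M.det := by
  have : (matrixEquiv M hM : Space d →ₗ[ℝ] Space d) = Matrix.toLpLin 2 2 M := rfl
  rw [this, LinearMap.det_toLpLin]

lemma matrixEquiv_apply {d : ℕ} (M : Matrix (Fin d) (Fin d) ℝ) (hM : IsUnit M.det) (x : Space d) :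
    matrixEquiv M hM x = WithLp.toLp 2 (M.mulVec x.ofLp) := rfl

lemma matrixEquiv_symm_apply {d : ℕ} (M : Matrix (Fin d) (Fin d) ℝ) (hM : IsUnit M.det)
    (x : Space d) : (matrixEquiv M hM).symm x = WithLp.toLp 2 (M⁻¹.mulVec x.ofLp) := rfl

lemma inner_matrixEquiv {d : ℕ} (M : Matrix (Fin d) (Fin d) ℝ) (hM : IsUnit M.det)
    (hM' : IsUnit M.transpose.det) (x y : Space d) :
    inner ℝ (matrixEquiv M hM x) y = inner ℝ x (matrixEquiv M.transpose hM' y) := by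
  rw [matrixEquiv_apply, matrixEquiv_apply, EuclideanSpace.inner_eq_star_dotProduct,
    EuclideanSpace.inner_eq_star_dotProduct]
  simp only [star_trivial]
  rw [Matrix.dotProduct_mulVec, Matrix.mulVec_transpose]

variable {n : ℕ}

/-- The factor `sgn(a)|a|^{1/(2n)}` by which the dilation acts on the last `2n - 1` coordinates. -/
def dilationFactor (n : ℕ) (a : ℝ) : ℝ := Real.sign a * |a| ^ (1 / (2 * (n : ℝ)))

lemma abs_dilationFactor {a : ℝ} (ha : a ≠ 0) :
    |dilationFactor n a| = |a| ^ (1 / (2 * (n : ℝ))) := by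
  rw [dilationFactor, abs_mul, abs_of_nonneg (Real.rpow_nonneg (abs_nonneg a) _)]
  rcases Real.sign_apply_eq_of_ne_zero a ha with h | h <;> simp [h]

lemma dilationFactor_ne_zero {a : ℝ} (ha : a ≠ 0) : dilationFactor n a ≠ 0 := by
  rw [← abs_ne_zero, abs_dilationFactor ha]
  exact (Real.rpow_pos_of_pos (abs_pos.2 ha) _).ne'

lemma shear_diag {n : ℕ} (s : Space (2 * n - 1)) (k : Fin (2 * n)) : shear s k k = 1 := by
  simp [shear]

lemma shear_fst {n : ℕ} (s : Space (2 * n - 1)) {k l : Fin (2 * n)} (hk : k.val = 0)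
    (hl : 0 < l.val) : shear s k l = s ⟨l.val - 1, by omega⟩ := by
  have hkl : k ≠ l := fun h => by rw [h] at hk; omega
  simp only [shear, Matrix.of_apply, if_neg hkl, dif_pos (And.intro hk hl)]

lemma shear_eq_zero {n : ℕ} (s : Space (2 * n - 1)) {k l : Fin (2 * n)} (hkl : k ≠ l)
    (h : ¬ (k.val = 0 ∧ 0 < l.val)) : shear s k l = 0 := by
  simp only [shear, Matrix.of_apply, if_neg hkl, dif_neg h]

lemma det_shear (s : Space (2 * n - 1)) : (shear s).det = 1 := by
  rw [Matrix.det_of_isUpperTriangular]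
  · simp [shear_diag]
  · intro k l hkl
    have : l < k := hkl
    have h0 : k.val ≠ 0 := by have : l.val < k.val := this; omega
    exact shear_eq_zero s this.ne' fun h => h0 h.1

variable [NeZero n]

/-- The index of the first coordinate of `ℝ²ⁿ`. -/
abbrev fstIdx (n : ℕ) [NeZero n] : Fin (2 * n) := ⟨0, Nat.mul_pos two_pos (NeZero.pos n)⟩

lemma abs_dilationFactor_pow {a : ℝ} (ha : a ≠ 0) :
    |dilationFactor n a| ^ (2 * n - 1) = |a| ^ (1 - 1 / (2 * (n : ℝ))) := by
  have hn : (n : ℝ) ≠ 0 := Nat.cast_ne_zero.2 (NeZero.ne n)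
  rw [abs_dilationFactor ha, ← Real.rpow_mul_natCast (abs_nonneg a),
    Nat.cast_sub (by have := NeZero.pos n; omega)]
  congr 1
  push_cast
  field_simp

lemma det_dilation (a : ℝ) : (dilation n a).det = a * dilationFactor n a ^ (2 * n - 1) := by
  rw [dilation, Matrix.det_diagonal, ← Finset.mul_prod_erase _ _ (Finset.mem_univ (fstIdx n)),
    if_pos rfl]
  congr 1
  rw [Finset.prod_congr rfl (g := fun _ => dilationFactor n a), Finset.prod_const,
    Finset.card_erase_of_mem (Finset.mem_univ _), Finset.card_univ, Fintype.card_fin]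
  intro k hk
  have : k.val ≠ 0 := fun h => (Finset.mem_erase.1 hk).1 (Fin.ext h)
  rw [if_neg this, dilationFactor]

lemma abs_det_shear_mul_dilation (s : Space (2 * n - 1)) {a : ℝ} (ha : a ≠ 0) :
    |(shear s * dilation n a).det| = |a| ^ (2 - 1 / (2 * (n : ℝ))) := by
  rw [Matrix.det_mul, det_shear, one_mul, det_dilation, abs_mul, abs_pow,
    abs_dilationFactor_pow ha]
  nth_rw 1 [← Real.rpow_one |a|]
  rw [← Real.rpow_add (abs_pos.2 ha)]
  congr 1
  ring

lemma isUnit_det_shear_mul_dilation (s : Space (2 * n - 1)) {a : ℝ} (ha : a ≠ 0) :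
    IsUnit (shear s * dilation n a).det := by
  rw [isUnit_iff_ne_zero, ← abs_ne_zero, abs_det_shear_mul_dilation s ha]
  exact (Real.rpow_pos_of_pos (abs_pos.2 ha) _).ne'

end Matrices

/-! ### Splitting off the first coordinate -/

section Coordinates

/-- The point `(x, y)` of `ℝ^{m+1}`, for `x ∈ ℝ` and `y ∈ ℝ^m`. -/
def joinCoord {d m : ℕ} (h : d = m + 1) (x : ℝ) (y : Space m) : Space d :=
  WithLp.toLp 2 fun k => if hk : k.val = 0 then x else y ⟨k.val - 1, by omega⟩

lemma joinCoord_fst {d m : ℕ} (h : d = m + 1) (x : ℝ) (y : Space m) {k : Fin d}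
    (hk : k.val = 0) : joinCoord h x y k = x := by
  simp only [joinCoord, dif_pos hk]

lemma joinCoord_succ {d m : ℕ} (h : d = m + 1) (x : ℝ) (y : Space m) {k : Fin d}
    (hk : k.val ≠ 0) : joinCoord h x y k = y ⟨k.val - 1, by omega⟩ := by
  simp only [joinCoord, dif_neg hk]

/-- The last `m` coordinates of a point of `ℝ^{m+1}`. -/
def tailCoord {d m : ℕ} (h : d = m + 1) (w : Space d) : Space m :=
  WithLp.toLp 2 fun k => w ⟨k.val + 1, by omega⟩

lemma measurePreserving_joinCoord {d m : ℕ} (h : d = m + 1) :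
    MeasurePreserving (fun p : ℝ × Space m => joinCoord h p.1 p.2) volume volume := by
  subst h
  have h1 : MeasurePreserving (Prod.map id WithLp.ofLp : ℝ × Space m → ℝ × (Fin m → ℝ))
      volume volume :=
    (MeasurePreserving.id (volume : Measure ℝ)).prod (PiLp.volume_preserving_ofLp (Fin m))
  have h2 := (volume_preserving_piFinSuccAbove (fun _ : Fin (m + 1) => ℝ) 0).symm
  have h3 := PiLp.volume_preserving_toLp (Fin (m + 1))
  have h4 := h3.comp (h2.comp h1)
  convert! h4 using 1
  ext p k
  refine Fin.cases ?_ (fun k => ?_) k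
  · simp [joinCoord]
  · simp [joinCoord]

lemma measurable_joinCoord {d m : ℕ} (h : d = m + 1) :
    Measurable (fun p : ℝ × Space m => joinCoord h p.1 p.2) :=
  (measurePreserving_joinCoord h).measurable

lemma lintegral_joinCoord {d m : ℕ} (h : d = m + 1) {G : Space d → ℝ≥0∞} (hG : Measurable G) :
    ∫⁻ w, G w = ∫⁻ x, ∫⁻ y, G (joinCoord h x y) := by
  rw [← (measurePreserving_joinCoord h).lintegral_comp hG, Measure.volume_eq_prod,
    lintegral_prod (fun p : ℝ × Space m => G (joinCoord h p.1 p.2))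
      (hG.comp (measurable_joinCoord h)).aemeasurable]

lemma lintegral_comp_smul_add_smul {m : ℕ} (G : Space m → ℝ≥0∞) {b c : ℝ}
    (hb : b ≠ 0) (hc : c ≠ 0) (y : Space m) :
    ∫⁻ s, G (c • (y + b • s)) = ENNReal.ofReal |((c * b) ^ m)⁻¹| * ∫⁻ s, G s := by
  have hcb : c * b ≠ 0 := mul_ne_zero hc hb
  have h1 := Measure.map_addHaar_smul (volume : Measure (Space m)) hcb
  rw [finrank_euclideanSpace, Fintype.card_fin] at h1
  have h2 := (measurableEmbedding_const_smul₀ (α := Space m) hcb).lintegral_map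
    (μ := volume) fun s => G (c • y + s)
  rw [h1, lintegral_smul_measure, lintegral_add_left_eq_self, smul_eq_mul] at h2
  rw [h2]
  simp only [smul_add, smul_smul]

lemma lintegral_comp_mul_right (G : ℝ → ℝ≥0∞) {b : ℝ} (hb : b ≠ 0) :
    ∫⁻ a, G (a * b) = ENNReal.ofReal |b⁻¹| * ∫⁻ a, G a := by
  have h2 := (Homeomorph.mulRight₀ b hb).measurableEmbedding.lintegral_map (μ := volume) G
  have h1 : Measure.map (Homeomorph.mulRight₀ b hb) (volume : Measure ℝ)
      = ENNReal.ofReal |b⁻¹| • volume := Real.map_volume_mul_right hb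
  rw [h1, lintegral_smul_measure, smul_eq_mul] at h2
  exact h2.symm

end Coordinates

/-! ### The complex shearlet transform on the Fourier side -/

section ComplexTransform

lemma measurableSet_ne_zero : MeasurableSet {a : ℝ | a ≠ 0} :=
  (measurableSet_singleton (0 : ℝ)).compl

instance sigmaFinite_comap_ne_zero :
    SigmaFinite ((volume : Measure ℝ).comap (Subtype.val : {a : ℝ // a ≠ 0} → ℝ)) := by
  have : LocallyCompactSpace {a : ℝ // a ≠ 0} := (isOpen_ne (x := (0 : ℝ))).locallyCompactSpace
  have : IsFiniteMeasureOnCompacts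
      ((volume : Measure ℝ).comap (Subtype.val : {a : ℝ // a ≠ 0} → ℝ)) :=
    .comap' _ continuous_subtype_val (MeasurableEmbedding.subtype_coe measurableSet_ne_zero)
  infer_instance

lemma lintegral_comap_ne_zero (G : ℝ → ℝ≥0∞) :
    ∫⁻ a : {a : ℝ // a ≠ 0}, G a ∂(volume : Measure ℝ).comap Subtype.val = ∫⁻ a, G a := by
  refine (lintegral_subtype_comap measurableSet_ne_zero G).trans ?_
  rw [show {a : ℝ | a ≠ 0} = {0}ᶜ from rfl, restrict_compl_singleton]

lemma sq_eLpNorm_two {X F : Type*} [MeasurableSpace X] [NormedAddCommGroup F] (f : X → F)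
    (μ : Measure X) : eLpNorm f 2 μ ^ 2 = ∫⁻ x, ‖f x‖ₑ ^ 2 ∂μ := by
  rw [eLpNorm_eq_lintegral_rpow_enorm_toReal (by simp) (by simp), ← ENNReal.rpow_natCast,
    ← ENNReal.rpow_mul]
  simp

variable {n : ℕ} [NeZero n]

lemma two_mul_eq : 2 * n = (2 * n - 1) + 1 := by have := NeZero.pos n; omega

/-- The image of `w` under the transpose of `S_s A_a`. -/
def dualPoint (a : ℝ) (s : Space (2 * n - 1)) (w : Space (2 * n)) : Space (2 * n) :=
  joinCoord two_mul_eq (a * w (fstIdx n))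
    (dilationFactor n a • (tailCoord two_mul_eq w + w (fstIdx n) • s))

lemma transpose_mulVec_eq_dualPoint (a : ℝ) (s : Space (2 * n - 1)) (w : Space (2 * n)) :
    WithLp.toLp 2 ((shear s * dilation n a).transpose.mulVec w.ofLp) = dualPoint a s w := by
  ext k
  have h1 : ((shear s * dilation n a).transpose.mulVec w.ofLp) k
      = (if k.val = 0 then a else dilationFactor n a) * ∑ l, shear s l k * w l := by
    simp only [Matrix.mulVec, dotProduct, Matrix.transpose_apply, dilation,
      Matrix.mul_diagonal, dilationFactor, Finset.mul_sum]
    refine Finset.sum_congr rfl fun l _ => ?_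
    ring
  change ((shear s * dilation n a).transpose.mulVec w.ofLp) k = _
  rw [h1]
  by_cases hk : k.val = 0
  · obtain rfl : k = fstIdx n := Fin.ext hk
    have h2 : ∑ l, shear s l (fstIdx n) * w l = w (fstIdx n) := by
      rw [Finset.sum_eq_single (fstIdx n), shear_diag, one_mul]
      · intro l _ hl
        rw [shear_eq_zero s hl fun h => h.2.ne rfl, zero_mul]
      · exact fun h => absurd (Finset.mem_univ _) h
    rw [h2, if_pos rfl, dualPoint, joinCoord_fst _ _ _ rfl]
  · have hk' : fstIdx n ≠ k := fun h => hk (congrArg Fin.val h.symm)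
    have h2 : ∑ l, shear s l k * w l
        = w k + s ⟨k.val - 1, by omega⟩ * w (fstIdx n) := by
      rw [← Finset.add_sum_erase _ _ (Finset.mem_univ k), shear_diag, one_mul,
        Finset.sum_eq_single (fstIdx n), shear_fst s rfl (Nat.pos_of_ne_zero hk)]
      · intro l hl hl'
        rw [shear_eq_zero s (Finset.mem_erase.1 hl).1 fun h => hl' (Fin.ext h.1), zero_mul]
      · intro h
        exact absurd (Finset.mem_erase.2 ⟨hk', Finset.mem_univ _⟩) h
    have h5 : (⟨k.val - 1 + 1, by omega⟩ : Fin (2 * n)) = k :=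
      Fin.ext (Nat.sub_add_cancel (Nat.pos_of_ne_zero hk))
    rw [h2, if_neg hk, dualPoint, joinCoord_succ _ _ _ hk]
    simp only [PiLp.smul_apply, PiLp.add_apply, smul_eq_mul, tailCoord, h5]
    ring

/-- The complex-valued shearlet `φ_{a,s,t}`. -/
def complexShearlet (φ : Space (2 * n) → ℂ) (p : Param n) (x : Space (2 * n)) : ℂ :=
  (|(p.1 : ℝ)| ^ (1 / (4 * (n : ℝ)) - 1)) •
    φ (WithLp.toLp 2
      ((dilation n (p.1 : ℝ))⁻¹.mulVec ((shear p.2.1)⁻¹.mulVec (x - p.2.2).ofLp)))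

/-- The Fourier transform of the shearlet `φ_{a,s,0}`, where `g` is that of `φ`. -/
def dualShearlet (g : Space (2 * n) → ℂ) (a : ℝ) (s : Space (2 * n - 1)) (w : Space (2 * n)) : ℂ :=
  (|a| ^ (1 - 1 / (4 * (n : ℝ)))) • g (dualPoint a s w)

/-- The linear part `S_s A_a` of the shearlet action, as an automorphism of `ℝ²ⁿ`. -/
def shearletEquiv (p : Param n) : Space (2 * n) ≃ₗ[ℝ] Space (2 * n) :=
  matrixEquiv (shear p.2.1 * dilation n p.1) (isUnit_det_shear_mul_dilation p.2.1 p.1.2)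

lemma shearletEquiv_symm_apply (p : Param n) (x : Space (2 * n)) :
    (shearletEquiv p).symm x = WithLp.toLp 2
      ((dilation n (p.1 : ℝ))⁻¹.mulVec ((shear p.2.1)⁻¹.mulVec x.ofLp)) := by
  rw [shearletEquiv, matrixEquiv_symm_apply, Matrix.mul_inv_rev, Matrix.mulVec_mulVec]

lemma abs_det_shearletEquiv (p : Param n) :
    |LinearMap.det (shearletEquiv p : Space (2 * n) →ₗ[ℝ] Space (2 * n))|
      = |(p.1 : ℝ)| ^ (2 - 1 / (2 * (n : ℝ))) := by
  rw [shearletEquiv, det_matrixEquiv, abs_det_shear_mul_dilation _ p.1.2]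

lemma isL2Fourier_complexShearlet {φ g : Space (2 * n) → ℂ} (h : IsL2Fourier φ g) (p : Param n) :
    IsL2Fourier (complexShearlet φ p) (fun w =>
      Complex.exp (↑(-2 * Real.pi * inner ℝ p.2.2 w) * Complex.I) * dualShearlet g p.1 p.2.1 w) := by
  have hT : IsUnit (shear p.2.1 * dilation n (p.1 : ℝ)).transpose.det := by
    rw [Matrix.det_transpose]
    exact isUnit_det_shear_mul_dilation p.2.1 p.1.2
  have h1 := (h.comp_affine (shearletEquiv p) (matrixEquiv _ hT)
    (fun x y => inner_matrixEquiv _ _ hT x y) p.2.2).const_smul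
    ((|(p.1 : ℝ)| ^ (1 / (4 * (n : ℝ)) - 1) : ℝ) : ℂ)
  have ha : 0 < |(p.1 : ℝ)| := abs_pos.2 p.1.2
  refine h1.congr (.of_forall fun x => ?_) (.of_forall fun w => ?_)
  · simp only [Pi.smul_apply, shearletEquiv_symm_apply, complexShearlet, Complex.coe_smul]
  · simp only [Pi.smul_apply, matrixEquiv_apply, transpose_mulVec_eq_dualPoint, dualShearlet,
      abs_det_shearletEquiv, Complex.coe_smul]
    rw [smul_smul, ← Real.rpow_add ha, mul_smul_comm]
    congr 2
    have hn : (n : ℝ) ≠ 0 := Nat.cast_ne_zero.2 (NeZero.ne n)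
    field_simp
    ring

/-- The complex-valued shearlet transform. -/
def complexTransform (φ f : Space (2 * n) → ℂ) (p : Param n) : ℂ :=
  ∫ x, f x * star (complexShearlet φ p x)

/-- The shearlet transform, as a function of the translation, is an inverse Fourier integral. -/
lemma complexTransform_eq_fourierInv {f f' φ g : Space (2 * n) → ℂ} (hf : IsL2Fourier f f')
    (h : IsL2Fourier φ g) (p : Param n) :
    complexTransform φ f p = 𝓕⁻ (fun w => f' w * star (dualShearlet g p.1 p.2.1 w)) p.2.2 := by
  rw [complexTransform, ← hf.integral_mul_star_eq (isL2Fourier_complexShearlet h p),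
    Real.fourierInv_eq']
  refine integral_congr_ae (.of_forall fun w => ?_)
  have : star (Complex.exp (↑(-2 * Real.pi * inner ℝ p.2.2 w) * Complex.I))
      = Complex.exp (↑(2 * Real.pi * inner ℝ w p.2.2) * Complex.I) := by
    rw [← starRingEnd_apply, ← Complex.exp_conj, real_inner_comm]
    simp [Complex.conj_ofNat]
  simp only [star_mul', this, smul_eq_mul]
  ring

lemma integrable_mul_star_dualShearlet {f' φ g : Space (2 * n) → ℂ} (hf : MemLp f' 2 volume)
    (h : IsL2Fourier φ g) (p : Param n) :
    Integrable fun w => f' w * star (dualShearlet g p.1 p.2.1 w) := by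
  have h1 := (isL2Fourier_complexShearlet h (p.1, p.2.1, 0)).2.1
  simp only [inner_zero_left, mul_zero, Complex.ofReal_zero, zero_mul, Complex.exp_zero,
    one_mul] at h1
  exact hf.integrable_mul h1.star

/-- Plancherel's theorem in the translation variable. Both sides may be infinite: the product
`f' * conj (dualShearlet g a s)` is integrable, but it need not be square integrable. -/
lemma lintegral_complexTransform_translation {f f' φ g : Space (2 * n) → ℂ}
    (hf : IsL2Fourier f f') (h : IsL2Fourier φ g) (a : {a : ℝ // a ≠ 0})
    (s : Space (2 * n - 1)) :
    ∫⁻ t, ‖complexTransform φ f (a, s, t)‖ₑ ^ 2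
      = ∫⁻ w, ‖f' w‖ₑ ^ 2 * (ENNReal.ofReal (|(a : ℝ)| ^ (2 - 1 / (2 * (n : ℝ))))
        * ‖g (dualPoint a s w)‖ₑ ^ 2) := by
  have h1 := eLpNorm_fourierInv_of_integrable
    (integrable_mul_star_dualShearlet hf.2.1 h (a, s, 0))
  have h2 := congrArg (· ^ 2) h1
  simp only [sq_eLpNorm_two] at h2
  simp only [complexTransform_eq_fourierInv hf h]
  rw [h2]
  refine lintegral_congr fun w => ?_
  have ha : 0 < |(a : ℝ)| := abs_pos.2 a.2
  rw [enorm_mul, mul_pow, dualShearlet]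
  congr 1
  have hs : ∀ z : ℂ, ‖star z‖ₑ = ‖z‖ₑ := fun z => by
    rw [← ofReal_norm, norm_star, ofReal_norm]
  rw [hs, enorm_smul, mul_pow]
  congr 1
  rw [Real.enorm_eq_ofReal (by positivity), ← ENNReal.ofReal_pow (by positivity),
    ← Real.rpow_mul_natCast ha.le]
  congr 2
  have hn : (n : ℝ) ≠ 0 := Nat.cast_ne_zero.2 (NeZero.ne n)
  field_simp
  push_cast
  ring

end ComplexTransform

/-! ### The norm identity for the complex shearlet transform -/

section Isometry

lemma measurable_dilationFactor (n : ℕ) : Measurable (dilationFactor n) := by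
  have h : Measurable Real.sign :=
    Measurable.ite measurableSet_Iio measurable_const
      (Measurable.ite measurableSet_Ioi measurable_const measurable_const)
  exact h.mul (by fun_prop)

lemma continuous_tailCoord {d m : ℕ} (h : d = m + 1) : Continuous (tailCoord h) := by
  unfold tailCoord; fun_prop

variable {n : ℕ} [NeZero n]

lemma measurable_dualPoint :
    Measurable fun q : ℝ × Space (2 * n - 1) × Space (2 * n) => dualPoint q.1 q.2.1 q.2.2 := by
  have h1 : Measurable fun q : ℝ × Space (2 * n - 1) × Space (2 * n) => q.2.2 (fstIdx n) := by
    fun_prop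
  have h2 : Measurable fun q : ℝ × Space (2 * n - 1) × Space (2 * n) =>
      tailCoord two_mul_eq q.2.2 :=
    (continuous_tailCoord two_mul_eq).measurable.comp (by fun_prop)
  have h3 : Measurable fun q : ℝ × Space (2 * n - 1) × Space (2 * n) => dilationFactor n q.1 :=
    (measurable_dilationFactor n).comp measurable_fst
  have h4 : Measurable fun q : ℝ × Space (2 * n - 1) × Space (2 * n) => q.2.1 := by fun_prop
  exact (measurable_joinCoord (two_mul_eq (n := n))).comp
    ((measurable_fst.mul h1).prodMk (h3.smul (h2.add (h1.smul h4))))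

/-- Measurability is read off from the Fourier side, where no inverse matrices occur. -/
lemma measurable_complexTransform {f f' φ g : Space (2 * n) → ℂ} (hf : IsL2Fourier f f')
    (h : IsL2Fourier φ g) (hf' : StronglyMeasurable f') (hg : StronglyMeasurable g) :
    Measurable (complexTransform φ f) := by
  have e : complexTransform φ f = fun p : Param n => ∫ w,
      Complex.exp (↑(2 * Real.pi * inner ℝ w p.2.2) * Complex.I)
        * (f' w * star (dualShearlet g p.1 p.2.1 w)) := by
    ext1 p
    rw [complexTransform_eq_fourierInv hf h, Real.fourierInv_eq']
    simp only [smul_eq_mul]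
  rw [e]
  refine (StronglyMeasurable.integral_prod_right'
    (f := fun q : Param n × Space (2 * n) =>
      Complex.exp (↑(2 * Real.pi * inner ℝ q.2 q.1.2.2) * Complex.I)
        * (f' q.2 * star (dualShearlet g q.1.1 q.1.2.1 q.2))) ?_).measurable
  refine Measurable.stronglyMeasurable ?_
  have h1 : Measurable fun q : Param n × Space (2 * n) =>
      dualPoint (q.1.1 : ℝ) q.1.2.1 q.2 :=
    measurable_dualPoint.comp (f := fun q : Param n × Space (2 * n) =>
      ((q.1.1 : ℝ), q.1.2.1, q.2)) (by fun_prop)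
  have h2 : Measurable fun q : Param n × Space (2 * n) =>
      dualShearlet g (q.1.1 : ℝ) q.1.2.1 q.2 := by
    have : Measurable fun q : Param n × Space (2 * n) =>
        |(q.1.1 : ℝ)| ^ (1 - 1 / (4 * (n : ℝ))) := by fun_prop
    exact this.smul (hg.measurable.comp h1)
  have h3 : Measurable fun q : Param n × Space (2 * n) => f' q.2 :=
    hf'.measurable.comp measurable_snd
  have h4 : Measurable fun q : Param n × Space (2 * n) =>
      Complex.exp (↑(2 * Real.pi * inner ℝ q.2 q.1.2.2) * Complex.I) := by fun_prop
  exact h4.mul (h3.mul (continuous_star.measurable.comp h2))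

/-- The `(a, s)`-integral over the dual orbit of `w` is the admissibility integral. -/
lemma lintegral_dualPoint {G : Space (2 * n) → ℝ≥0∞} (hG : Measurable G) {w : Space (2 * n)}
    (hw : w (fstIdx n) ≠ 0) :
    ∫⁻ a : ℝ, ∫⁻ s, ENNReal.ofReal (1 / |a| ^ (2 * n + 1))
        * (ENNReal.ofReal (|a| ^ (2 - 1 / (2 * (n : ℝ)))) * G (dualPoint a s w))
      = ∫⁻ v : Space (2 * n), G v / ENNReal.ofReal (|v (fstIdx n)| ^ (2 * n)) := by
  set b := w (fstIdx n) with hb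
  set m := 2 * n - 1 with hm
  have hn : (n : ℝ) ≠ 0 := Nat.cast_ne_zero.2 (NeZero.ne n)
  have hjoin : Measurable fun p : ℝ × Space m => G (joinCoord two_mul_eq p.1 p.2) :=
    hG.comp (measurable_joinCoord _)
  set H : ℝ → ℝ≥0∞ := fun x =>
    (∫⁻ y, G (joinCoord two_mul_eq x y)) / ENNReal.ofReal (|x| ^ (2 * n)) with hH
  have hHm : Measurable H := by
    refine Measurable.div ?_ (by fun_prop)
    exact Measurable.lintegral_prod_right' hjoin
  have hjs : ∀ x : ℝ, Measurable fun y => G (joinCoord (two_mul_eq (n := n)) x y) := fun x =>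
    hjoin.comp (measurable_const.prodMk measurable_id)
  -- Both sides reduce to integrals of `H`, the admissibility integrand integrated over the last
  -- `2n - 1` coordinates.
  have rhs : ∫⁻ v : Space (2 * n), G v / ENNReal.ofReal (|v (fstIdx n)| ^ (2 * n))
      = ∫⁻ x, H x := by
    have hGd : Measurable fun v : Space (2 * n) =>
        G v / ENNReal.ofReal (|v (fstIdx n)| ^ (2 * n)) := hG.div (by fun_prop)
    rw [lintegral_joinCoord two_mul_eq hGd]
    refine lintegral_congr fun x => ?_
    simp only [joinCoord_fst two_mul_eq x _ (rfl : (fstIdx n).val = 0), div_eq_mul_inv, hH]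
    rw [lintegral_mul_const _ (hjs x)]
  have lhs : ∀ a : ℝ, a ≠ 0 → ∫⁻ s, ENNReal.ofReal (1 / |a| ^ (2 * n + 1))
        * (ENNReal.ofReal (|a| ^ (2 - 1 / (2 * (n : ℝ)))) * G (dualPoint a s w))
      = ENNReal.ofReal |b| * H (a * b) := by
    intro a ha
    have ha' : 0 < |a| := abs_pos.2 ha
    have hb' : 0 < |b| := abs_pos.2 hw
    have hc := dilationFactor_ne_zero (n := n) ha
    have hms : Measurable fun s : Space m => G (dualPoint a s w) :=
      hG.comp (measurable_dualPoint.comp (f := fun s : Space m => (a, s, w)) (by fun_prop))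
    rw [lintegral_const_mul _ (hms.const_mul _), lintegral_const_mul _ hms]
    simp only [dualPoint]
    rw [lintegral_comp_smul_add_smul (fun y => G (joinCoord two_mul_eq (a * b) y)) hw hc]
    simp only [hH, ENNReal.div_eq_inv_mul]
    have hab : 0 < |a * b| ^ (2 * n) := pow_pos (abs_pos.2 (mul_ne_zero ha hw)) _
    rw [← ENNReal.ofReal_inv_of_pos hab, ← mul_assoc, ← mul_assoc, ← mul_assoc,
      ← ENNReal.ofReal_mul (by positivity), ← ENNReal.ofReal_mul (by positivity),
      ← ENNReal.ofReal_mul (by positivity)]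
    congr 2
    rw [abs_inv, abs_pow, abs_mul, mul_pow, abs_dilationFactor_pow ha, abs_mul, mul_pow,
      Real.rpow_sub ha', Real.rpow_sub ha', Real.rpow_one, Real.rpow_two]
    have hr : |a| ^ (1 / (2 * (n : ℝ))) ≠ 0 := (Real.rpow_pos_of_pos ha' _).ne'
    have hbm : |b| ^ (2 * n) = |b| ^ (2 * n - 1) * |b| := by
      rw [← pow_succ, ← two_mul_eq]
    rw [hbm, pow_succ |a| (2 * n)]
    field_simp
  rw [rhs]
  have h1 : ∫⁻ a : ℝ, ∫⁻ s, ENNReal.ofReal (1 / |a| ^ (2 * n + 1))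
        * (ENNReal.ofReal (|a| ^ (2 - 1 / (2 * (n : ℝ)))) * G (dualPoint a s w))
      = ∫⁻ a : ℝ, ENNReal.ofReal |b| * H (a * b) := by
    refine lintegral_congr_ae ?_
    filter_upwards [Measure.ae_ne volume (0 : ℝ)] with a ha
    exact lhs a ha
  have h2 : Measurable fun a => H (a * b) := hHm.comp (measurable_mul_const b)
  rw [h1, lintegral_const_mul _ h2, lintegral_comp_mul_right H hw, ← mul_assoc,
    ← ENNReal.ofReal_mul (abs_nonneg _), ← abs_mul,
    mul_inv_cancel₀ hw, abs_one, ENNReal.ofReal_one, one_mul]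

/-- The complex shearlet transform is a multiple of an isometry. -/
lemma lintegral_complexTransform {f φ g : Space (2 * n) → ℂ} (hf : MemLp f 2 volume)
    (h : IsL2Fourier φ g) (hg : StronglyMeasurable g) :
    ∫⁻ p, ‖complexTransform φ f p‖ₑ ^ 2 ∂haarLeft n
      = (∫⁻ v : Space (2 * n), ‖g v‖ₑ ^ 2 / ENNReal.ofReal (|v (fstIdx n)| ^ (2 * n)))
        * ∫⁻ x, ‖f x‖ₑ ^ 2 := by
  obtain ⟨f', hf', hff'⟩ := exists_isL2Fourier hf
  have hTm : Measurable fun p => ‖complexTransform φ f p‖ₑ ^ 2 :=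
    (measurable_complexTransform hff' h hf' hg).enorm.pow_const 2
  have hdens : Measurable fun p : Param n => ENNReal.ofReal (1 / |(p.1 : ℝ)| ^ (2 * n + 1)) := by
    fun_prop
  have hgm : Measurable fun v => ‖g v‖ₑ ^ 2 := hg.measurable.enorm.pow_const 2
  have hfm : Measurable fun v => ‖f' v‖ₑ ^ 2 := hf'.measurable.enorm.pow_const 2
  rw [haarLeft, lintegral_withDensity_eq_lintegral_mul _ hdens hTm,
    lintegral_prod _ (hdens.mul hTm).aemeasurable]
  -- The integrand after the integration over `t`.
  set K : ℝ → Space (2 * n - 1) → Space (2 * n) → ℝ≥0∞ := fun a s w =>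
    ‖f' w‖ₑ ^ 2 * (ENNReal.ofReal (1 / |a| ^ (2 * n + 1))
      * (ENNReal.ofReal (|a| ^ (2 - 1 / (2 * (n : ℝ)))) * ‖g (dualPoint a s w)‖ₑ ^ 2)) with hK
  have hKm : Measurable fun q : ℝ × Space (2 * n - 1) × Space (2 * n) => K q.1 q.2.1 q.2.2 := by
    have h1 : Measurable fun q : ℝ × Space (2 * n - 1) × Space (2 * n) =>
        ‖g (dualPoint q.1 q.2.1 q.2.2)‖ₑ ^ 2 := hgm.comp measurable_dualPoint
    have h2 : Measurable fun q : ℝ × Space (2 * n - 1) × Space (2 * n) => ‖f' q.2.2‖ₑ ^ 2 :=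
      hfm.comp (by fun_prop)
    exact h2.mul (Measurable.mul (by fun_prop) (Measurable.mul (by fun_prop) h1))
  have h1 : ∀ a : {a : ℝ // a ≠ 0}, ∫⁻ q : Space (2 * n - 1) × Space (2 * n),
      ((fun p : Param n => ENNReal.ofReal (1 / |(p.1 : ℝ)| ^ (2 * n + 1)))
        * fun p => ‖complexTransform φ f p‖ₑ ^ 2) (a, q)
        ∂(volume : Measure (Space (2 * n - 1))).prod volume
      = ∫⁻ w, ∫⁻ s, K a s w := by
    intro a
    have hTa : ∀ s, Measurable fun t => ‖complexTransform φ f (a, s, t)‖ₑ ^ 2 := fun s =>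
      hTm.comp (by fun_prop : Measurable fun t : Space (2 * n) => (a, s, t))
    have hp : Measurable fun q : Space (2 * n - 1) × Space (2 * n) =>
        ((fun p : Param n => ENNReal.ofReal (1 / |(p.1 : ℝ)| ^ (2 * n + 1)))
          * fun p => ‖complexTransform φ f p‖ₑ ^ 2) (a, q) :=
      (hdens.mul hTm).comp measurable_prodMk_left
    rw [lintegral_prod _ hp.aemeasurable]
    rw [lintegral_lintegral_swap (f := fun w s => K a s w)]
    · refine lintegral_congr fun s => ?_
      simp only [Pi.mul_apply]
      rw [lintegral_const_mul _ (hTa s), lintegral_complexTransform_translation hff' h]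
      rw [← lintegral_const_mul']
      · refine lintegral_congr fun w => ?_
        simp only [hK]
        ring
      · exact ENNReal.ofReal_ne_top
    · exact (hKm.comp (by fun_prop : Measurable fun q : Space (2 * n) × Space (2 * n - 1) =>
        ((a : ℝ), q.2, q.1))).aemeasurable
  rw [lintegral_congr h1, lintegral_comap_ne_zero fun a => ∫⁻ w, ∫⁻ s, K a s w,
    lintegral_lintegral_swap]
  · have h2 : ∀ᵐ w : Space (2 * n), ∫⁻ a : ℝ, ∫⁻ s, K a s w = ‖f' w‖ₑ ^ 2 *
        ∫⁻ v : Space (2 * n), ‖g v‖ₑ ^ 2 / ENNReal.ofReal (|v (fstIdx n)| ^ (2 * n)) := by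
      filter_upwards [ae_apply_ne_zero (fstIdx n)] with w hw
      rw [← lintegral_dualPoint hgm hw]
      have hfin : ‖f' w‖ₑ ^ 2 ≠ ⊤ := by finiteness
      rw [← lintegral_const_mul' _ _ hfin]
      refine lintegral_congr fun a => ?_
      rw [← lintegral_const_mul' _ _ hfin]
    rw [lintegral_congr_ae h2, lintegral_mul_const _ hfm, mul_comm, ← sq_eLpNorm_two,
      ← sq_eLpNorm_two, hff'.eLpNorm_eq]
  · clear_value K
    have e : Measurable fun r : (ℝ × Space (2 * n)) × Space (2 * n - 1) =>
        (r.1.1, r.2, r.1.2) := by fun_prop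
    have h3 : Measurable fun r : (ℝ × Space (2 * n)) × Space (2 * n - 1) => K r.1.1 r.2 r.1.2 :=
      hKm.comp e
    have h4 : Measurable fun r : ℝ × Space (2 * n) => ∫⁻ s, K r.1 s r.2 :=
      Measurable.lintegral_prod_right' h3
    exact h4.aemeasurable

end Isometry

/-! ### The quaternion shearlet transform -/

section QuaternionTransform

lemma integrable_mul_star {X : Type*} [MeasurableSpace X] {μ : Measure X} {f g : X → ℍ[ℝ]}
    (hf : MemLp f 2 μ) (hg : MemLp g 2 μ) : Integrable (fun x => f x * star (g x)) μ :=
  hf.integrable_mul hg.star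

/-- The Cauchy–Schwarz inequality for the quaternionic inner product. -/
lemma enorm_integral_mul_star_le {X : Type*} [MeasurableSpace X] {μ : Measure X}
    {f g : X → ℍ[ℝ]} (hf : MemLp f 2 μ) (hg : MemLp g 2 μ) :
    ‖∫ x, f x * star (g x) ∂μ‖ₑ ≤ eLpNorm f 2 μ * eLpNorm g 2 μ := by
  have h1 : eLpNorm (fun x => star (g x)) 2 μ = eLpNorm g 2 μ :=
    eLpNorm_congr_norm_ae (.of_forall fun x => norm_star _)
  have h2 := eLpNorm_smul_le_mul_eLpNorm (p := 2) (q := 2) (r := 1) hg.star.1 hf.1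
  calc ‖∫ x, f x * star (g x) ∂μ‖ₑ ≤ ∫⁻ x, ‖f x * star (g x)‖ₑ ∂μ :=
        enorm_integral_le_lintegral_enorm _
    _ = eLpNorm (f • fun x => star (g x)) 1 μ := by rw [eLpNorm_one_eq_lintegral_enorm]; rfl
    _ ≤ _ := by rw [← h1]; exact h2

lemma eq_of_re_mul_eq {q q' : ℍ[ℝ]} (h : ∀ c : ℍ[ℝ], (c * q).re = (c * q').re) : q = q' := by
  have h1 := h (star (q - q'))
  have h2 : Quaternion.normSq (star (q - q')) = 0 := by
    rw [Quaternion.normSq_def, star_star, mul_sub, Quaternion.re_sub, h1, sub_self]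
  simpa [sub_eq_zero] using h2

variable {n : ℕ}

lemma innerQ_congr {f f' g g' : Space (2 * n) → ℍ[ℝ]} (hf : f =ᵐ[volume] f')
    (hg : g =ᵐ[volume] g') : innerQ f g = innerQ f' g' := by
  refine integral_congr_ae ?_
  filter_upwards [hf, hg] with x h1 h2
  rw [h1, h2]

lemma shearletTransform_smul (ψ f : Space (2 * n) → ℍ[ℝ]) (c : ℝ) :
    shearletTransform ψ (c • f) = c • shearletTransform ψ f := by
  ext1 p
  simp only [shearletTransform, innerQ, Pi.smul_apply, smul_mul_assoc]
  exact integral_smul _ _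

lemma shearletTransform_congr {ψ f g : Space (2 * n) → ℍ[ℝ]} (h : f =ᵐ[volume] g) :
    shearletTransform ψ f = shearletTransform ψ g :=
  funext fun _ => innerQ_congr h .rfl

variable [NeZero n]

lemma shearlet_eq (ψ : Space (2 * n) → ℍ[ℝ]) (p : Param n) :
    shearlet ψ p = (|(p.1 : ℝ)| ^ (1 / (4 * (n : ℝ)) - 1)) •
      fun x => ψ ((shearletEquiv p).symm (x - p.2.2)) := by
  ext1 x
  simp only [Pi.smul_apply, shearletEquiv_symm_apply, shearlet]

lemma memLp_shearlet {ψ : Space (2 * n) → ℍ[ℝ]} (hψ : MemLp ψ 2 volume) (p : Param n) :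
    MemLp (shearlet ψ p) 2 volume := by
  rw [shearlet_eq]
  exact ((memLp_comp_linearEquiv (shearletEquiv p).symm hψ).comp_measurePreserving
    (measurePreserving_sub_right volume p.2.2)).const_smul _

/-- The shearlet action is unitary. -/
lemma eLpNorm_shearlet {ψ : Space (2 * n) → ℍ[ℝ]} (hψ : MemLp ψ 2 volume) (p : Param n) :
    eLpNorm (shearlet ψ p) 2 volume = eLpNorm ψ 2 volume := by
  have ha : 0 < |(p.1 : ℝ)| := abs_pos.2 p.1.2
  have hn : (n : ℝ) ≠ 0 := Nat.cast_ne_zero.2 (NeZero.ne n)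
  have h1 := eLpNorm_comp_measurePreserving (p := 2)
    (memLp_comp_linearEquiv (shearletEquiv p).symm hψ).1
    (measurePreserving_sub_right volume p.2.2)
  rw [Function.comp_def] at h1
  rw [shearlet_eq, eLpNorm_const_smul, h1, eLpNorm_comp_linearEquiv, LinearEquiv.det_coe_symm,
    inv_inv, abs_det_shearletEquiv, smul_eq_mul, ← mul_assoc,
    Real.enorm_eq_ofReal (by positivity), ENNReal.ofReal_rpow_of_pos (by positivity),
    ← ENNReal.ofReal_mul (by positivity), ← Real.rpow_mul ha.le, ← Real.rpow_add ha]
  have h2 : 1 / (4 * (n : ℝ)) - 1 + (2 - 1 / (2 * (n : ℝ))) * (1 / (2 : ℝ≥0∞)).toReal = 0 := by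
    simp
    field_simp
    ring
  rw [h2, Real.rpow_zero, ENNReal.ofReal_one, one_mul]

lemma shearlet_ae_eq {ψ : Space (2 * n) → ℍ[ℝ]} (h2 : ∀ᵐ z, sndComp (ψ z) = 0) (p : Param n) :
    shearlet ψ p =ᵐ[volume] fun x => ofComplexJ (complexShearlet (fun z => fstComp (ψ z)) p x) := by
  have hq : Measure.QuasiMeasurePreserving (shearletEquiv p).symm
      (volume : Measure (Space (2 * n))) volume := by
    refine ⟨(measurableEmbedding_linearEquiv _).measurable, ?_⟩
    rw [map_linearEquiv_volume]
    exact Measure.smul_absolutelyContinuous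
  have h3 := (measurePreserving_sub_right volume p.2.2).quasiMeasurePreserving.ae (hq.ae h2)
  filter_upwards [h3] with x hx
  rw [shearletEquiv_symm_apply] at hx
  apply ext_comps
  · simp [shearlet, complexShearlet]
  · simp only [shearlet, map_smul, hx, smul_zero, sndComp_ofComplexJ]

lemma comps_shearletTransform {ψ f : Space (2 * n) → ℍ[ℝ]} (hψ : MemLp ψ 2 volume)
    (h2 : ∀ᵐ z, sndComp (ψ z) = 0) (hf : MemLp f 2 volume) (p : Param n) :
    shearletTransform ψ f p
      = ofComps (complexTransform (fun z => fstComp (ψ z)) (fun x => fstComp (f x)) p)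
          (complexTransform (fun z => fstComp (ψ z)) (fun x => sndComp (f x)) p) := by
  have hi := integrable_mul_star hf (memLp_shearlet hψ p)
  have hae := shearlet_ae_eq h2 p
  apply ext_comps
  · rw [fstComp_ofComps, shearletTransform, innerQ, ← fstComp.integral_comp_comm hi]
    refine integral_congr_ae ?_
    filter_upwards [hae] with x hx
    rw [hx, star_ofComplexJ, fstComp_mul_ofComplexJ]
  · rw [sndComp_ofComps, shearletTransform, innerQ, ← sndComp.integral_comp_comm hi]
    refine integral_congr_ae ?_
    filter_upwards [hae] with x hx
    rw [hx, star_ofComplexJ, sndComp_mul_ofComplexJ]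

lemma shearletTransform_add {ψ f g : Space (2 * n) → ℍ[ℝ]} (hψ : MemLp ψ 2 volume)
    (hf : MemLp f 2 volume) (hg : MemLp g 2 volume) :
    shearletTransform ψ (f + g) = shearletTransform ψ f + shearletTransform ψ g := by
  ext1 p
  have hp := memLp_shearlet hψ p
  simp only [shearletTransform, innerQ, Pi.add_apply, add_mul]
  exact integral_add (integrable_mul_star hf hp) (integrable_mul_star hg hp)

lemma shearletTransform_const_mul {ψ f : Space (2 * n) → ℍ[ℝ]} (hψ : MemLp ψ 2 volume)
    (hf : MemLp f 2 volume) (c : ℍ[ℝ]) :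
    shearletTransform ψ (fun x => c * f x) = fun p => c * shearletTransform ψ f p := by
  ext1 p
  simp only [shearletTransform, innerQ, mul_assoc]
  exact integral_const_mul_of_integrable (integrable_mul_star hf (memLp_shearlet hψ p))

variable {ψ : Space (2 * n) → ℍ[ℝ]}

lemma stronglyMeasurable_shearletTransform (hψ : MemLp ψ 2 volume) (hc : ConvolutionCondition ψ)
    {f : Space (2 * n) → ℍ[ℝ]} (hf : MemLp f 2 volume) :
    StronglyMeasurable (shearletTransform ψ f) := by
  obtain ⟨h2, g, hgm, hg, -⟩ := hc.exists_fourier hψ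
  obtain ⟨f₁, hm₁, hf₁⟩ := exists_isL2Fourier (memLp_iff_comps.1 hf).1
  obtain ⟨f₂, hm₂, hf₂⟩ := exists_isL2Fourier (memLp_iff_comps.1 hf).2
  rw [funext fun p => comps_shearletTransform hψ h2 hf p]
  exact continuous_ofComps.comp_stronglyMeasurable
    ((measurable_complexTransform hf₁ hg hm₁ hgm).stronglyMeasurable.prodMk
      (measurable_complexTransform hf₂ hg hm₂ hgm).stronglyMeasurable)

/-- The quaternion shearlet transform multiplies the squared norm by the admissibility integral. -/
lemma lintegral_shearletTransform (hψ : MemLp ψ 2 volume) (hc : ConvolutionCondition ψ)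
    {f : Space (2 * n) → ℍ[ℝ]} (hf : MemLp f 2 volume) :
    ∫⁻ p, ‖shearletTransform ψ f p‖ₑ ^ 2 ∂haarLeft n
      = admissibilityIntegral ψ * ∫⁻ x, ‖f x‖ₑ ^ 2 := by
  obtain ⟨h2, g, hgm, hg, hC⟩ := hc.exists_fourier hψ
  obtain ⟨f₁, hm₁, hf₁⟩ := exists_isL2Fourier (memLp_iff_comps.1 hf).1
  simp only [comps_shearletTransform hψ h2 hf, enorm_sq_eq_comps, fstComp_ofComps,
    sndComp_ofComps]
  rw [lintegral_add_left ((measurable_complexTransform hf₁ hg hm₁ hgm).enorm.pow_const 2),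
    lintegral_complexTransform (memLp_iff_comps.1 hf).1 hg hgm,
    lintegral_complexTransform (memLp_iff_comps.1 hf).2 hg hgm, hC, ← mul_add,
    lintegral_add_left' ((memLp_iff_comps.1 hf).1.1.enorm.pow_const 2)]

lemma eLpNorm_shearletTransform_sq (hψ : MemLp ψ 2 volume) (hc : ConvolutionCondition ψ)
    {f : Space (2 * n) → ℍ[ℝ]} (hf : MemLp f 2 volume) :
    eLpNorm (shearletTransform ψ f) 2 (haarLeft n) ^ 2
      = admissibilityIntegral ψ * eLpNorm f 2 volume ^ 2 := by
  rw [sq_eLpNorm_two, sq_eLpNorm_two, lintegral_shearletTransform hψ hc hf]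

lemma memLp_shearletTransform (hψ : Admissible ψ) (hc : ConvolutionCondition ψ)
    {f : Space (2 * n) → ℍ[ℝ]} (hf : MemLp f 2 volume) :
    MemLp (shearletTransform ψ f) 2 (haarLeft n) := by
  refine ⟨(stronglyMeasurable_shearletTransform hψ.1 hc hf).aestronglyMeasurable, ?_⟩
  have h := eLpNorm_shearletTransform_sq hψ.1 hc hf
  by_contra hne
  rw [not_lt, top_le_iff] at hne
  rw [hne] at h
  have : admissibilityIntegral ψ * eLpNorm f 2 volume ^ 2 < ⊤ :=
    ENNReal.mul_lt_top hψ.2 (ENNReal.pow_lt_top hf.2)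
  rw [← h] at this
  simp at this

lemma admissibilityConst_pos (hψ : Admissible ψ) (hψ0 : ¬ ψ =ᵐ[volume] 0)
    (hc : ConvolutionCondition ψ) : 0 < admissibilityConst ψ := by
  refine ENNReal.toReal_pos (fun h0 => hψ0 ?_) hψ.2.ne
  obtain ⟨h2, g, hgm, hg, hC⟩ := hc.exists_fourier hψ.1
  have hm : Measurable fun w : Space (2 * n) => ‖g w‖ₑ ^ 2 /
      ENNReal.ofReal (|w (fstIdx n)| ^ (2 * n)) :=
    (hgm.measurable.enorm.pow_const 2).div (by fun_prop)
  rw [hC, lintegral_eq_zero_iff hm] at h0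
  have hg0 : g =ᵐ[volume] 0 := by
    filter_upwards [h0] with w hw
    simpa [ENNReal.div_eq_zero_iff] using hw
  have h1 := hg.eLpNorm_eq
  rw [eLpNorm_congr_ae hg0, eLpNorm_zero] at h1
  filter_upwards [h2, (eLpNorm_eq_zero_iff hg.1.1 two_ne_zero).1 h1.symm] with z hz2 hz1
  exact ext_comps (by simpa using hz1) (by simpa using hz2)

/-- The shearlet transform on `L²`, normalized so as to be a linear isometry. -/
def transformIsometry (hψ : Admissible ψ) (hψ0 : ¬ ψ =ᵐ[volume] 0)
    (hc : ConvolutionCondition ψ) :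
    Lp ℍ[ℝ] 2 (volume : Measure (Space (2 * n))) →ₗᵢ[ℝ] Lp ℍ[ℝ] 2 (haarLeft n) where
  toFun f := (Real.sqrt (admissibilityConst ψ))⁻¹ •
    (memLp_shearletTransform hψ hc (Lp.memLp f)).toLp (shearletTransform ψ f)
  map_add' f g := by
    have hf := memLp_shearletTransform hψ hc (Lp.memLp f)
    have hg := memLp_shearletTransform hψ hc (Lp.memLp g)
    rw [← smul_add, ← MemLp.toLp_add hf hg]
    congr 1
    refine MemLp.toLp_congr _ (hf.add hg) (.of_eq ?_)
    rw [shearletTransform_congr (Lp.coeFn_add f g),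
      shearletTransform_add hψ.1 (Lp.memLp f) (Lp.memLp g)]
  map_smul' c f := by
    have h := memLp_shearletTransform hψ hc (Lp.memLp f)
    rw [RingHom.id_apply, smul_comm, ← MemLp.toLp_const_smul c h]
    congr 1
    refine MemLp.toLp_congr _ (h.const_smul c) (.of_eq ?_)
    rw [shearletTransform_congr (Lp.coeFn_smul c f), shearletTransform_smul]
  norm_map' f := by
    have hC := admissibilityConst_pos hψ hψ0 hc
    have h := congrArg ENNReal.toReal (eLpNorm_shearletTransform_sq hψ.1 hc (Lp.memLp f))
    rw [ENNReal.toReal_mul, ENNReal.toReal_pow, ENNReal.toReal_pow] at h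
    change ‖(Real.sqrt (admissibilityConst ψ))⁻¹ •
      (memLp_shearletTransform hψ hc (Lp.memLp f)).toLp (shearletTransform ψ f)‖ = _
    rw [norm_smul, Lp.norm_toLp, Lp.norm_def, norm_inv, Real.norm_of_nonneg (Real.sqrt_nonneg _),
      ← sq_eq_sq₀ (by positivity) (by positivity), mul_pow, h, inv_pow, Real.sq_sqrt hC.le]
    exact inv_mul_cancel_left₀ hC.ne' _

lemma transformIsometry_toLp (hψ : Admissible ψ) (hψ0 : ¬ ψ =ᵐ[volume] 0)
    (hc : ConvolutionCondition ψ) {f : Space (2 * n) → ℍ[ℝ]} (hf : MemLp f 2 volume) :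
    transformIsometry hψ hψ0 hc (hf.toLp f) = (Real.sqrt (admissibilityConst ψ))⁻¹ •
      (memLp_shearletTransform hψ hc hf).toLp (shearletTransform ψ f) := by
  change (Real.sqrt (admissibilityConst ψ))⁻¹ • (memLp_shearletTransform hψ hc
    (Lp.memLp (hf.toLp f))).toLp (shearletTransform ψ (hf.toLp f)) = _
  congr 1
  exact MemLp.toLp_congr _ _ (.of_eq (shearletTransform_congr hf.coeFn_toLp))

lemma re_integral_mul_star {X : Type*} [MeasurableSpace X] {μ : Measure X} {f g : X → ℍ[ℝ]}
    (hf : MemLp f 2 μ) (hg : MemLp g 2 μ) :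
    (∫ x, f x * star (g x) ∂μ).re = inner ℝ (hf.toLp f) (hg.toLp g) := by
  have h1 : (∫ x, f x * star (g x) ∂μ).re = (fstComp (∫ x, f x * star (g x) ∂μ)).re := rfl
  rw [h1, ← fstComp.integral_comp_comm (integrable_mul_star hf hg), ← RCLike.re_eq_complex_re,
    ← integral_re (fstComp.integrable_comp (integrable_mul_star hf hg)), L2.inner_def]
  refine integral_congr_ae ?_
  filter_upwards [hf.coeFn_toLp, hg.coeFn_toLp] with x h2 h3
  rw [h2, h3, Quaternion.inner_def]
  rfl

/-- The orthogonality relation for the quaternion shearlet transform. -/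
lemma integral_shearletTransform_mul_star (hψ : Admissible ψ) (hψ0 : ¬ ψ =ᵐ[volume] 0)
    (hc : ConvolutionCondition ψ) {f g : Space (2 * n) → ℍ[ℝ]} (hf : MemLp f 2 volume)
    (hg : MemLp g 2 volume) :
    ∫ p, shearletTransform ψ f p * star (shearletTransform ψ g p) ∂haarLeft n
      = admissibilityConst ψ • innerQ f g := by
  have hC := admissibilityConst_pos hψ hψ0 hc
  have hre : ∀ {f : Space (2 * n) → ℍ[ℝ]}, MemLp f 2 volume →
      (∫ p, shearletTransform ψ f p * star (shearletTransform ψ g p) ∂haarLeft n).re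
        = admissibilityConst ψ * (innerQ f g).re := by
    intro f hf
    rw [re_integral_mul_star (memLp_shearletTransform hψ hc hf)
      (memLp_shearletTransform hψ hc hg), innerQ, re_integral_mul_star hf hg,
      ← (transformIsometry hψ hψ0 hc).inner_map_map, transformIsometry_toLp,
      transformIsometry_toLp, real_inner_smul_left, real_inner_smul_right, ← mul_assoc,
      ← mul_assoc]
    rw [mul_assoc (admissibilityConst ψ), ← mul_inv, Real.mul_self_sqrt hC.le,
      mul_inv_cancel₀ hC.ne', one_mul]
  -- Both sides are left linear in `f`, so their real parts determine them.
  refine eq_of_re_mul_eq fun c => ?_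
  have hcf : MemLp (fun x => c * f x) 2 volume := hf.const_mul c
  have h1 := hre hcf
  rw [shearletTransform_const_mul hψ.1 hf] at h1
  have h2 : innerQ (fun x => c * f x) g = c * innerQ f g := by
    simp only [innerQ, mul_assoc]
    exact integral_const_mul_of_integrable (integrable_mul_star hf hg)
  simp only [mul_assoc] at h1
  rw [integral_const_mul_of_integrable (integrable_mul_star (memLp_shearletTransform hψ hc hf)
    (memLp_shearletTransform hψ hc hg)), h2] at h1
  rw [h1, mul_smul_comm, Quaternion.re_smul, smul_eq_mul]

lemma shearletKernel_eq (ψ : Space (2 * n) → ℍ[ℝ]) (p : Param n) :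
    shearletKernel ψ p
      = shearletTransform ψ ((1 / admissibilityConst ψ) • shearlet ψ p) := by
  rw [shearletTransform_smul]
  rfl

/-- The range of the shearlet transform is a reproducing kernel Hilbert space. -/
lemma isRKHSInL2_transformRange (hψ : Admissible ψ) (hψ0 : ¬ ψ =ᵐ[volume] 0)
    (hc : ConvolutionCondition ψ) :
    IsRKHSInL2 (haarLeft n) (transformRange ψ) (shearletKernel ψ) where
  memLp := by
    rintro _ ⟨f, hf, rfl⟩
    exact memLp_shearletTransform hψ hc hf
  zero_mem := ⟨0, MemLp.zero, by ext1 p; simp [shearletTransform, innerQ]⟩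
  add_mem := by
    rintro _ ⟨f, hf, rfl⟩ _ ⟨g, hg, rfl⟩
    exact ⟨f + g, hf.add hg, (shearletTransform_add hψ.1 hf hg).symm⟩
  smul_mem := by
    rintro c _ ⟨f, hf, rfl⟩
    exact ⟨fun x => c * f x, hf.const_mul c, (shearletTransform_const_mul hψ.1 hf c).symm⟩
  eq_of_ae_eq := by
    rintro _ ⟨f, hf, rfl⟩ _ ⟨g, hg, rfl⟩ h
    have h1 : transformIsometry hψ hψ0 hc (hf.toLp f) = transformIsometry hψ hψ0 hc (hg.toLp g) := by
      rw [transformIsometry_toLp, transformIsometry_toLp, MemLp.toLp_congr _ _ h]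
    have h2 := (transformIsometry hψ hψ0 hc).injective h1
    exact shearletTransform_congr ((MemLp.toLp_eq_toLp_iff hf hg).1 h2)
  isClosed := by
    have hC := admissibilityConst_pos hψ hψ0 hc
    have hs : Real.sqrt (admissibilityConst ψ) ≠ 0 := (Real.sqrt_pos.2 hC).ne'
    convert! (transformIsometry hψ hψ0 hc).isometry.isClosedEmbedding.isClosed_range using 1
    ext Φ
    constructor
    · rintro ⟨_, ⟨f, hf, rfl⟩, hΦ⟩
      refine ⟨Real.sqrt (admissibilityConst ψ) • hf.toLp f, ?_⟩
      rw [map_smul, transformIsometry_toLp, smul_smul, mul_inv_cancel₀ hs, one_smul]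
      exact Lp.ext ((MemLp.coeFn_toLp _).trans hΦ.symm)
    · rintro ⟨f, rfl⟩
      refine ⟨_, ⟨(Real.sqrt (admissibilityConst ψ))⁻¹ • f, (Lp.memLp f).const_smul _, rfl⟩, ?_⟩
      rw [shearletTransform_smul]
      refine (Lp.coeFn_smul _ _).trans ?_
      filter_upwards [(memLp_shearletTransform hψ hc (Lp.memLp f)).coeFn_toLp] with p hp
      rw [Pi.smul_apply, Pi.smul_apply, hp]
  kernel_mem p := ⟨_, (memLp_shearlet hψ.1 p).const_smul _, shearletKernel_eq ψ p⟩
  reproducing := by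
    rintro _ ⟨f, hf, rfl⟩ p
    have hC := admissibilityConst_pos hψ hψ0 hc
    have hp := (memLp_shearlet hψ.1 p).const_smul (1 / admissibilityConst ψ)
    rw [shearletKernel_eq]
    refine ⟨integrable_mul_star (memLp_shearletTransform hψ hc hf)
      (memLp_shearletTransform hψ hc hp), ?_⟩
    rw [integral_shearletTransform_mul_star hψ hψ0 hc hf hp, shearletTransform]
    simp only [innerQ, Pi.smul_apply, Quaternion.star_smul, mul_smul_comm]
    rw [integral_smul, smul_smul, mul_one_div_cancel hC.ne', one_smul]

lemma norm_shearletKernel_le (hψ : MemLp ψ 2 volume) (hC : 0 < admissibilityConst ψ)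
    (p q : Param n) :
    ‖shearletKernel ψ p q‖ ≤ (eLpNorm ψ 2 volume).toReal ^ 2 / admissibilityConst ψ := by
  have h1 := enorm_integral_mul_star_le (memLp_shearlet hψ p) (memLp_shearlet hψ q)
  rw [eLpNorm_shearlet hψ, eLpNorm_shearlet hψ, ← sq] at h1
  have h2 := ENNReal.toReal_mono (ENNReal.pow_ne_top hψ.2.ne) h1
  rw [toReal_enorm, ENNReal.toReal_pow] at h2
  rw [shearletKernel, norm_smul, Real.norm_of_nonneg (by positivity), one_div_mul_eq_div]
  exact div_le_div_of_nonneg_right h2 hC.le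

end QuaternionTransform

end QShearlet

end

theorem mainTheorem3 (n : ℕ) [NeZero n]
    (ψ : QShearlet.Space (2 * n) → ℍ[ℝ])
    (hψ : QShearlet.Admissible ψ)
    (hψ0 : ¬ ψ =ᵐ[volume] 0)
    (hconv : QShearlet.ConvolutionCondition ψ) :
    0 < QShearlet.admissibilityConst ψ ∧
    QShearlet.IsRKHSInL2 (QShearlet.haarLeft n) (QShearlet.transformRange ψ)
      (QShearlet.shearletKernel ψ) ∧
    ∀ p q : QShearlet.Param n,
      ‖QShearlet.shearletKernel ψ p q‖ ≤
        (eLpNorm ψ 2 volume).toReal ^ 2 / QShearlet.admissibilityConst ψ := by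
  have hC := QShearlet.admissibilityConst_pos hψ hψ0 hconv
  exact ⟨hC, QShearlet.isRKHSInL2_transformRange hψ hψ0 hconv,
    fun p q => QShearlet.norm_shearletKernel_le hψ.1 hC p q⟩
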